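/- Let $V_{\mathbb R}$ be a finite-dimensional real vector space with a scalar product, $V=\mathbb C\otimes V_{\mathbb R}$, $\ell=\dim V$, and let $W\subset O(V_{\mathbb R})$ be a finite group generated by reflections, with set of reflections $S$. For $s\in S$ let $\alpha_s$ be a root of $s$ (a nonzero vector orthogonal to its mirror). Let $c(s)$, $s\in S$, be independent formal parameters constant on $W$-conjugacy classes, $\mathbb C(c)$ the field of rational functions in them, and $S_c(V)=\mathbb C(c)\otimes S(V)$. The Dunkl operators on $S_c(V)$ are $$\nabla_y=\partial_y-\sum_{s\in S}c(s)\frac{\langle y,\alpha_s\rangle}{\alpha_s}(1-s),\qquad y\in V^*;$$ they commute, so that $\nabla_P$ is defined for $P\in S_c(V)\cong S_c(V^*)$ (identified by the scalar product) by $\nabla_{P+Q}=\nabla_P+\nabla_Q$, $\nabla_{PQ}=\nabla_P\nabla_Q$. Let $(f,g)_c$ be the constant term of $\nabla_f(g)$. Let $d_1\le\dots\le d_\ell$ be the degrees of $W$, i.e. the degrees of homogeneous elements $u_1,\dots,u_\ell$ such that $S(V)^W=\mathbb C[u_1,\dots,u_\ell]$ is a polynomial algebra (a homogeneous generating set, $\deg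 u_i=d_i$), and put $h=d_\ell$ if $\ell\ge 1$. For $a,a'\in\mathbb Z_{\ge0}^\ell$ write $a'\prec a$ if the last nonzero coordinate of $a-a'$ is positive. A canonical invariant $b_a$ is a homogeneous element of $S_c(V)^W$ such that for every homogeneous generating set $u_1,\dots,u_\ell$ one has $b_a\in\mathbb C^\times u^a+\sum_{a'\prec a}\mathbb C(c)u^{a'}$ and $(u^{a'},b_a)_c=0$ for all $a'\prec a$. Let $e_d^{(c)}$ denote $b_a$ for the $\prec$-largest $a$ with $\sum_i d_ia_i=d$. **Theorem.** Suppose that $d_1<\dots<d_\ell$ are pairwise distinct. Then canonical invariants $e_{d_1}^{(c)},\dots,e_{d_\ell}^{(c)}$ exist, and, for any choice of them: (a) The elements $e_{d_1}^{(c)},\dots,e_{d_\ell}^{(c)}$ generate the $\mathbb C(c)$-algebra $S_c(V)^W$. (b) For each $k$, the element $e_{d_k}^{(c)}$ of $S_c(V)^W$ is nonzero and homogeneous of degree $d_k$, and a homogeneous element $f\in S_c(V)^W$ of degree $d_k$ satisfies $\nabla_P(f)=0$ for all $P\in S_c(V)^W$ with zero constant term and $\deg P<d_k$ if and only if $f$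 is a $\mathbb C(c)$-multiple of $e_{d_k}^{(c)}$. (c) If $\ell\ge1$, then for each $k=1,2,\dots$ there is a canonical invariant $e_{kh}^{(c)}\in S_c(V)^W$, nonzero and homogeneous of degree $kh$, such that a homogeneous element $f\in S_c(V)^W$ of degree $kh$ satisfies $\nabla_P(f)=0$ for all $P\in S(V)^W$ with zero constant term and $\deg P<h$ if and only if $f$ is a $\mathbb C(c)$-multiple of $e_{kh}^{(c)}$. -/

import Mathlib

/-! Invariants of a finite real reflection group `W` acting on a Euclidean space `E`, and Dunkl
operators with formal parameters. An orthonormal basis `b` of `E` identifies the symmetric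
algebra of `k ⊗ E` with the polynomial ring `MvPolynomial (Fin ℓ) k`, the basis vector `b i`
corresponding to the variable `X i`; it also identifies `E` with its dual. -/

open MvPolynomial

noncomputable section

namespace Dunkl

variable {E : Type*} [NormedAddCommGroup E] [InnerProductSpace ℝ E] {ℓ : ℕ}

/-- A vector `v`, as a linear element of the symmetric algebra with coefficients in `k`. -/
def linForm (k : Type*) [CommRing k] [Algebra ℝ k] (b : OrthonormalBasis (Fin ℓ) ℝ E) (v : E) :
    MvPolynomial (Fin ℓ) k :=
  ∑ i, C (algebraMap ℝ k (inner ℝ (b i) v)) * X i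

/-- The action of an isometry `w` on the symmetric algebra: the algebra endomorphism that
extends the action of `w` on vectors. -/
def act (k : Type*) [CommRing k] [Algebra ℝ k] (b : OrthonormalBasis (Fin ℓ) ℝ E)
    (w : E ≃ₗᵢ[ℝ] E) : MvPolynomial (Fin ℓ) k →ₐ[k] MvPolynomial (Fin ℓ) k :=
  aeval fun j => linForm k b (w (b j))

/-- The algebra of `W`-invariants. -/
def invariants (k : Type*) [CommRing k] [Algebra ℝ k] (b : OrthonormalBasis (Fin ℓ) ℝ E)
    (W : Subgroup (E ≃ₗᵢ[ℝ] E)) : Subalgebra k (MvPolynomial (Fin ℓ) k) where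
  carrier := {f | ∀ w ∈ W, act k b w f = f}
  mul_mem' := fun hf hg w hw => by rw [map_mul, hf w hw, hg w hw]
  add_mem' := fun hf hg w hw => by rw [map_add, hf w hw, hg w hw]
  algebraMap_mem' := fun r w _ => (act k b w).commutes r

/-- The orthogonal reflection in the hyperplane `α^⊥`. -/
def reflectionIn (α : E) : E ≃ₗᵢ[ℝ] E := (ℝ ∙ α)ᗮ.reflection

/-- `s` is the orthogonal reflection in some hyperplane. -/
def IsReflection (s : E ≃ₗᵢ[ℝ] E) : Prop := ∃ α : E, α ≠ 0 ∧ s = reflectionIn α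

/-- The set `S` of reflections in `W`. -/
abbrev Refl (W : Subgroup (E ≃ₗᵢ[ℝ] E)) : Type _ := {s : W // IsReflection (s : E ≃ₗᵢ[ℝ] E)}

/-- The set `S / W` of orbits of `W` acting on its reflections by conjugation. -/
abbrev ReflClass (W : Subgroup (E ≃ₗᵢ[ℝ] E)) : Type _ :=
  Quotient ((IsConj.setoid W).comap (fun s : Refl W => s.1))

/-- The field `ℂ(c)` of rational functions in independent variables indexed by `S / W`. -/
abbrev ParamField (W : Subgroup (E ≃ₗᵢ[ℝ] E)) : Type _ :=
  FractionRing (MvPolynomial (ReflClass W) ℂ)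

/-- The parameter `c(s)`: the variable of the class of the reflection `s`. -/
def param (W : Subgroup (E ≃ₗᵢ[ℝ] E)) (s : Refl W) : ParamField W :=
  algebraMap (MvPolynomial (ReflClass W) ℂ) (ParamField W) (X (Quotient.mk _ s))

/-- A root of the reflection `s`: a nonzero vector orthogonal to its mirror (determined up to a
nonzero scalar, which does not affect the Dunkl operators). -/
def root {W : Subgroup (E ≃ₗᵢ[ℝ] E)} (s : Refl W) : E := s.2.choose

theorem root_ne_zero {W : Subgroup (E ≃ₗᵢ[ℝ] E)} (s : Refl W) : root s ≠ 0 :=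
  s.2.choose_spec.1

theorem eq_reflectionIn_root {W : Subgroup (E ≃ₗᵢ[ℝ] E)} (s : Refl W) :
    (s : E ≃ₗᵢ[ℝ] E) = reflectionIn (root s) :=
  s.2.choose_spec.2

section DividedDifference

variable (k : Type*) [Field k] [Algebra ℝ k] (b : OrthonormalBasis (Fin ℓ) ℝ E)

theorem linForm_add (v w : E) : linForm k b (v + w) = linForm k b v + linForm k b w := by
  simp [linForm, inner_add_right, add_mul, Finset.sum_add_distrib]

theorem linForm_smul (r : ℝ) (v : E) :
    linForm k b (r • v) = C (algebraMap ℝ k r) * linForm k b v := by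
  simp [linForm, inner_smul_right, Finset.mul_sum, mul_assoc]

theorem linForm_basis (j : Fin ℓ) : linForm k b (b j) = X j := by
  simp [linForm, orthonormal_iff_ite.mp b.orthonormal]

theorem linForm_ne_zero {v : E} (hv : v ≠ 0) : linForm k b v ≠ 0 := by
  intro h
  apply hv
  refine b.repr.map_eq_zero_iff.mp (PiLp.ext fun i => ?_)
  have h1 := congrArg (MvPolynomial.coeff (Finsupp.single i 1)) h
  simp only [linForm, coeff_sum, coeff_C_mul, coeff_X, coeff_zero] at h1
  simp [Finsupp.single_left_inj] at h1
  simpa [b.repr_apply_apply] using h1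

theorem linForm_dvd (α : E) (f : MvPolynomial (Fin ℓ) k) :
    linForm k b α ∣ f - act k b (reflectionIn α) f := by
  induction f using MvPolynomial.induction_on with
  | C r => simp [act]
  | add p q hp hq =>
    rw [map_add, add_sub_add_comm]
    exact dvd_add hp hq
  | mul_X p j hp =>
    have hj : linForm k b α ∣ X j - act k b (reflectionIn α) (X j) := by
      obtain ⟨r, hr⟩ : ∃ r : ℝ, b j = reflectionIn α (b j) + r • α := by
        refine ⟨2 * (inner ℝ α (b j) / ((‖α‖ : ℝ) ^ 2)), ?_⟩
        rw [reflectionIn, Submodule.reflection_orthogonal_apply,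
          Submodule.reflection_singleton_apply]
        simp [mul_smul, two_smul]
      have : (X j : MvPolynomial (Fin ℓ) k)
          = act k b (reflectionIn α) (X j) + C (algebraMap ℝ k r) * linForm k b α := by
        rw [← linForm_smul, act, aeval_X, ← linForm_add, ← hr, linForm_basis]
      exact ⟨C (algebraMap ℝ k r), by linear_combination this⟩
    have : p * X j - act k b (reflectionIn α) (p * X j)
        = (p - act k b (reflectionIn α) p) * X j
          + act k b (reflectionIn α) p * (X j - act k b (reflectionIn α) (X j)) := by
      rw [map_mul]; ring
    rw [this]
    exact dvd_add (hp.mul_right _) (hj.mul_left _)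

/-- The operator `f ↦ (f - s f) / α`, where `s` is the reflection in `α^⊥`: the value at `f` is
the unique polynomial whose product with the linear form `α` is `f - s f`. -/
def dividedDiff (α : E) (hα : α ≠ 0) :
    MvPolynomial (Fin ℓ) k →ₗ[k] MvPolynomial (Fin ℓ) k where
  toFun f := (linForm_dvd k b α f).choose
  map_add' f g := by
    refine mul_left_cancel₀ (linForm_ne_zero k b hα) ?_
    rw [mul_add, ← (linForm_dvd k b α f).choose_spec, ← (linForm_dvd k b α g).choose_spec,
      ← (linForm_dvd k b α (f + g)).choose_spec, map_add]
    ring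
  map_smul' r f := by
    refine mul_left_cancel₀ (linForm_ne_zero k b hα) ?_
    rw [RingHom.id_apply, mul_smul_comm, ← (linForm_dvd k b α f).choose_spec,
      ← (linForm_dvd k b α (r • f)).choose_spec, map_smul, smul_sub]

end DividedDifference

section Operators

variable (b : OrthonormalBasis (Fin ℓ) ℝ E) (W : Subgroup (E ≃ₗᵢ[ℝ] E))

/-- The algebra `S_c(V)`: polynomials with coefficients in `ℂ(c)`. -/
abbrev Sc (ℓ : ℕ) (W : Subgroup (E ≃ₗᵢ[ℝ] E)) : Type _ := MvPolynomial (Fin ℓ) (ParamField W)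

/-- The inclusion of `S(V)` into `S_c(V)`. -/
def toSc (ℓ : ℕ) (W : Subgroup (E ≃ₗᵢ[ℝ] E)) : MvPolynomial (Fin ℓ) ℂ →+* Sc ℓ W :=
  MvPolynomial.map (algebraMap ℂ (ParamField W))

/-- The directional derivative `∂_y`: the derivation with `∂_y v = ⟨y, v⟩` for vectors `v`. -/
def dirDeriv (y : E) : Module.End (ParamField W) (Sc ℓ W) :=
  (mkDerivation (ParamField W)
    (fun i => (C (algebraMap ℝ (ParamField W) (inner ℝ y (b i))) : Sc ℓ W))).toLinearMap

/-- The Dunkl operator `∇_y = ∂_y - ∑_{s ∈ S} c(s) (⟨y, α_s⟩ / α_s) (1 - s)`. -/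
def dunklOp (y : E) : Module.End (ParamField W) (Sc ℓ W) :=
  dirDeriv b W y - ∑ᶠ s : Refl W,
    (param W s * algebraMap ℝ (ParamField W) (inner ℝ y (root s))) •
      dividedDiff (ParamField W) b (root s) (root_ne_zero s)

/-- The operator `∇_p` for a polynomial `p`, obtained from `p` by substituting the Dunkl operator
`∇_{b i}` for the variable `X i`. (Dunkl operators commute, so the order of the factors, here
that of increasing indices, is immaterial, and `∇_{pq} = ∇_p ∇_q`.) -/
def dunklPoly (p : Sc ℓ W) : Module.End (ParamField W) (Sc ℓ W) :=
  ∑ m ∈ p.support, p.coeff m • (List.ofFn fun i => dunklOp b W (b i) ^ m i).prod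

/-- The form `(f, g)_c`, the constant term of `∇_f g`. -/
def dunklForm (f g : Sc ℓ W) : ParamField W := constantCoeff (dunklPoly b W f g)

/-- `u` is a homogeneous generating set of `S(V)^W` with degrees `d`: the `u i` are homogeneous
of degree `d i`, and `S(V)^W` is the algebra of polynomials in the `u i`. -/
def IsHomogeneousGeneratingSet (d : Fin ℓ → ℕ) (u : Fin ℓ → MvPolynomial (Fin ℓ) ℂ) : Prop :=
  (∀ i, (u i).IsHomogeneous (d i)) ∧ AlgebraicIndependent ℂ u ∧
    Algebra.adjoin ℂ (Set.range u) = invariants ℂ b W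

open Classical in
/-- The degrees `d_1 ≤ ⋯ ≤ d_ℓ` of `W`: the degrees of a homogeneous generating set of `S(V)^W`
in increasing order. Such sets exist for finite reflection groups by Chevalley's theorem, and
their degrees do not depend on any choice. -/
def degrees : Fin ℓ → ℕ :=
  if h : ∃ d : Fin ℓ → ℕ, Monotone d ∧ ∃ u, IsHomogeneousGeneratingSet b W d u then h.choose
  else 0

/-- The inverse lexicographic order `a' ≺ a`: the last nonzero coordinate of `a - a'` is
positive. -/
def Prec (a' a : Fin ℓ → ℕ) : Prop := ∃ i, a' i < a i ∧ ∀ j, i < j → a' j = a j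

/-- The monomial `u^a` in the elements `u i`, viewed in `S_c(V)`. -/
def monom (u : Fin ℓ → MvPolynomial (Fin ℓ) ℂ) (a : Fin ℓ → ℕ) : Sc ℓ W :=
  toSc ℓ W (∏ i, u i ^ a i)

/-- `f` is a canonical invariant `b_a`: a homogeneous element of `S_c(V)^W` such that, for every
homogeneous generating set `u` of `S(V)^W`, `f` lies in `ℂ^× u^a + ∑_{a' ≺ a} ℂ(c) u^{a'}` and is
orthogonal to every `u^{a'}` with `a' ≺ a`. -/
def IsCanonicalInvariant (a : Fin ℓ → ℕ) (f : Sc ℓ W) : Prop :=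
  f ∈ invariants (ParamField W) b W ∧ (∃ n, f.IsHomogeneous n) ∧
    ∀ u, IsHomogeneousGeneratingSet b W (degrees b W) u →
      (∃ z : ℂ, z ≠ 0 ∧
        f - z • monom W u a ∈
          Submodule.span (ParamField W) {g | ∃ a', Prec a' a ∧ g = monom W u a'}) ∧
      ∀ a', Prec a' a → dunklForm b W (monom W u a') f = 0

/-- `f` is a canonical invariant `e_n^{(c)}`, i.e. `b_a` where `a` is the largest element, in the
inverse lexicographic order, of the set of all `a` with `∑ d_i a_i = n`. -/
def IsElementary (n : ℕ) (f : Sc ℓ W) : Prop :=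
  ∃ a : Fin ℓ → ℕ, ∑ i, degrees b W i * a i = n ∧
    (∀ a' : Fin ℓ → ℕ, ∑ i, degrees b W i * a' i = n → a' = a ∨ Prec a' a) ∧
    IsCanonicalInvariant b W a f

end Operators

end Dunkl

end

/-! Dunkl operators commute, and the form `(f, g)_c` is nondegenerate on finite-dimensional
subspaces of `S(V)` stable under complex conjugation, by specialization at `c = 0`. The canonical
invariants are then obtained by orthogonalization. -/

/-! The canonical invariants come from Gram–Schmidt orthogonalization of the monomials `u^a`,
ordered by `≺`, with respect to `(f, g)_c`. Two facts about the form carry everything.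

Since Dunkl operators commute (`dunklOp_comm_apply`), `p ↦ ∇_p` is multiplicative, hence `(pq, f)_c
= (p, ∇_q f)_c` (`dunklForm_mul`): Dunkl equations and orthogonality relations translate into each
other.

The form is nondegenerate on the `ℂ(c)`-span of a finite independent family of complex polynomials
whose complex span is stable under conjugation (`det_dunklForm_ne_zero`). Its Gram determinant is a
polynomial in `c`, and at `c = 0` Dunkl operators become partial derivatives, for which pairing a
nonzero polynomial with its conjugate gives a positive number.

When the degrees are distinct, two homogeneous generating sets differ by a triangular substitution.
So the span `low` of the monomials of the degree of `u^a` that precede it does not depend on `u` and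
is stable under conjugation; projecting `u^a` away from it gives an invariant canonical for all
generating sets at once.

Let `e` be canonical for `a = n ε_k`, the largest exponent of its degree. If `0 < deg u^p < d_k`,
each `u^q u^p` of the degree of `e` precedes `u^a`, so `∇_{u^p} e` is orthogonal to all invariants
of its degree and vanishes. Conversely, each monomial of `low` contains some `u_i` with `i < k`;
hence if `∇_{u_i} f = 0` for all `i < k`, then `f` minus a suitable multiple of `e` lies in `low`
and is orthogonal to it, so it is zero. Taking `n = 1` gives the elementary invariants, and `k` last
gives the quasiharmonic ones. Generation follows from triangularity. -/

noncomputable section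

namespace Dunkl

variable {E : Type*} [NormedAddCommGroup E] [InnerProductSpace ℝ E] {ℓ : ℕ}

/-! ### The action of isometries on polynomials, and divided differences. -/

section Action

variable (k : Type*) [Field k] [Algebra ℝ k] (b : OrthonormalBasis (Fin ℓ) ℝ E)

theorem linForm_sum {ι : Type*} (t : Finset ι) (v : ι → E) :
    linForm k b (∑ i ∈ t, v i) = ∑ i ∈ t, linForm k b (v i) :=
  map_sum (AddMonoidHom.mk' (linForm k b) (linForm_add k b)) v t

theorem act_X (w : E ≃ₗᵢ[ℝ] E) (j : Fin ℓ) : act k b w (X j) = linForm k b (w (b j)) := by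
  simp [act]

theorem act_linForm (w : E ≃ₗᵢ[ℝ] E) (v : E) :
    act k b w (linForm k b v) = linForm k b (w v) := by
  conv_rhs => rw [← b.sum_repr v, map_sum, linForm_sum]
  rw [linForm, map_sum]
  refine Finset.sum_congr rfl fun i _ => ?_
  rw [map_mul, act_X, map_smul, linForm_smul, b.repr_apply_apply]
  congr 1
  exact (act k b w).commutes _

theorem act_mul_apply (w w' : E ≃ₗᵢ[ℝ] E) (f : MvPolynomial (Fin ℓ) k) :
    act k b (w * w') f = act k b w (act k b w' f) := by
  suffices h : act k b (w * w') = (act k b w).comp (act k b w') by rw [h]; rfl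
  refine MvPolynomial.algHom_ext fun j => ?_
  rw [AlgHom.comp_apply, act_X, act_X, act_linForm]
  rfl

theorem act_C (w : E ≃ₗᵢ[ℝ] E) (r : k) : act k b w (C r) = C r :=
  (act k b w).commutes r

theorem linForm_isHomogeneous (v : E) : (linForm k b v).IsHomogeneous 1 := by
  refine MvPolynomial.IsHomogeneous.sum _ _ _ fun i _ => ?_
  simpa using (isHomogeneous_C (Fin ℓ) (algebraMap ℝ k (inner ℝ (b i) v))).mul
    (isHomogeneous_X k i)

theorem act_isHomogeneous (w : E ≃ₗᵢ[ℝ] E) {f : MvPolynomial (Fin ℓ) k} {n : ℕ}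
    (hf : f.IsHomogeneous n) : (act k b w f).IsHomogeneous n := by
  have := hf.aeval (fun j => linForm k b (w (b j))) (n := 1)
    fun i => linForm_isHomogeneous k b _
  rwa [one_mul] at this

theorem reflectionIn_apply (α v : E) :
    reflectionIn α v = v - (2 * inner ℝ α v / inner ℝ α α) • α := by
  rw [reflectionIn, Submodule.reflection_orthogonal_apply,
    Submodule.reflection_singleton_apply, real_inner_self_eq_norm_sq]
  simp only [RCLike.ofReal_real_eq_id, id]
  rw [mul_div_assoc, mul_smul, neg_sub, two_smul ℝ, two_smul ℕ]

theorem inner_self_ne_zero_of_ne {α : E} (hα : α ≠ 0) : (inner ℝ α α : ℝ) ≠ 0 :=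
  inner_self_ne_zero.mpr hα

theorem conj_reflectionIn (w : E ≃ₗᵢ[ℝ] E) (α : E) :
    w * reflectionIn α * w⁻¹ = reflectionIn (w α) := by
  ext v
  have hv : w (w⁻¹ v) = v := w.apply_symm_apply v
  have h2 : (inner ℝ α (w⁻¹ v) : ℝ) = inner ℝ (w α) v := by
    rw [← w.inner_map_map, hv]
  rw [LinearIsometryEquiv.coe_mul, LinearIsometryEquiv.coe_mul, Function.comp_apply,
    Function.comp_apply, reflectionIn_apply, reflectionIn_apply, map_sub, map_smul, hv, h2,
    w.inner_map_map]

/-- A reflection negates its root, and `α` minus its image under the reflection in `β` is a multiple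
of `β`. Needed because `root` is a choice: `w` carries the chosen root of `s` to that of `w s w⁻¹`
only up to a scalar. -/
theorem exists_smul_of_reflectionIn_eq {α β : E} (hα : α ≠ 0)
    (h : reflectionIn α = reflectionIn β) : ∃ r : ℝ, r ≠ 0 ∧ α = r • β := by
  have h1 : reflectionIn α α = -α := by
    rw [reflectionIn_apply, mul_div_assoc, div_self (inner_self_ne_zero_of_ne hα), mul_one, two_smul]
    abel
  rw [h, reflectionIn_apply] at h1
  have h2 : α = ((1 / 2 : ℝ) * (2 * inner ℝ β α / inner ℝ β β)) • β := by
    have h3 : (2 * inner ℝ β α / inner ℝ β β : ℝ) • β = (2 : ℝ) • α := by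
      rw [two_smul, ← sub_neg_eq_add α α, ← h1, sub_sub_cancel]
    rw [mul_smul, h3, smul_smul]
    norm_num
  refine ⟨_, fun h0 => hα ?_, h2⟩
  rw [h2, h0, zero_smul]

theorem linForm_mul_dividedDiff (α : E) (hα : α ≠ 0) (f : MvPolynomial (Fin ℓ) k) :
    linForm k b α * dividedDiff k b α hα f = f - act k b (reflectionIn α) f :=
  ((linForm_dvd k b α f).choose_spec).symm

/-- Cancellation of the linear form in a domain; the identities for divided differences below are
checked after multiplication by it. -/
theorem dividedDiff_eq {α : E} (hα : α ≠ 0) {f g : MvPolynomial (Fin ℓ) k}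
    (h : linForm k b α * g = f - act k b (reflectionIn α) f) : dividedDiff k b α hα f = g :=
  mul_left_cancel₀ (linForm_ne_zero k b hα) ((linForm_mul_dividedDiff k b α hα f).trans h.symm)

theorem act_dividedDiff (w : E ≃ₗᵢ[ℝ] E) {α : E} (hα : α ≠ 0) (hwα : w α ≠ 0)
    (f : MvPolynomial (Fin ℓ) k) :
    act k b w (dividedDiff k b α hα f) = dividedDiff k b (w α) hwα (act k b w f) := by
  refine (dividedDiff_eq k b hwα ?_).symm
  rw [← act_linForm, ← map_mul, linForm_mul_dividedDiff, map_sub, ← act_mul_apply,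
    ← conj_reflectionIn, ← act_mul_apply, inv_mul_cancel_right]

theorem dividedDiff_smul_root {α β : E} (hα : α ≠ 0) (hβ : β ≠ 0) {r : ℝ} (hr : r ≠ 0)
    (h : α = r • β) (f : MvPolynomial (Fin ℓ) k) :
    algebraMap ℝ k r • dividedDiff k b α hα f = dividedDiff k b β hβ f := by
  have hs : reflectionIn α = reflectionIn β := by
    ext v
    have : (inner ℝ β β : ℝ) ≠ 0 := inner_self_ne_zero_of_ne hβ
    rw [reflectionIn_apply, reflectionIn_apply, h, smul_smul, inner_smul_left, inner_smul_left,
      inner_smul_right]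
    congr 2
    simp only [conj_trivial]
    field_simp
  refine (dividedDiff_eq k b hβ ?_).symm
  have hlin : linForm k b α = C (algebraMap ℝ k r) * linForm k b β := by rw [h, linForm_smul]
  rw [← hs, ← linForm_mul_dividedDiff k b α hα, hlin, smul_eq_C_mul]
  ring

theorem dividedDiff_C {α : E} (hα : α ≠ 0) (r : k) : dividedDiff k b α hα (C r) = 0 :=
  dividedDiff_eq k b hα (by rw [act_C, sub_self, mul_zero])

/-- Twisted Leibniz rule: `v f - s(v) s(f) = v (f - s f) + (v - s v) s f`, and `v - s v` is a
multiple of `α`. -/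
theorem dividedDiff_linForm_mul {α : E} (hα : α ≠ 0) (v : E) (f : MvPolynomial (Fin ℓ) k) :
    dividedDiff k b α hα (linForm k b v * f) = linForm k b v * dividedDiff k b α hα f +
      C (algebraMap ℝ k (2 * inner ℝ α v / inner ℝ α α)) * act k b (reflectionIn α) f := by
  refine dividedDiff_eq k b hα ?_
  have h := linForm_mul_dividedDiff k b α hα f
  have h2 : linForm k b v = act k b (reflectionIn α) (linForm k b v)
      + C (algebraMap ℝ k (2 * inner ℝ α v / inner ℝ α α)) * linForm k b α := by
    rw [act_linForm, ← linForm_smul, ← linForm_add, reflectionIn_apply, sub_add_cancel]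
  rw [map_mul]
  linear_combination linForm k b v * h - act k b (reflectionIn α) f * h2

end Action

/-- The component of degree `m + n` of `p q` is `p` times the component of degree `n` of `q`; cancel
`p`. -/
theorem isHomogeneous_of_mul_left {σ R : Type*} [Field R] {p q : MvPolynomial σ R}
    {m n : ℕ} (hp : p.IsHomogeneous m) (hp0 : p ≠ 0) (h : (p * q).IsHomogeneous (m + n)) :
    q.IsHomogeneous n := by
  suffices hq : homogeneousComponent n q = q by
    rw [← hq]; exact homogeneousComponent_isHomogeneous n q
  refine mul_left_cancel₀ hp0 ?_
  conv_rhs => rw [← homogeneousComponent_eq_self h]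
  conv_rhs => rw [← sum_homogeneousComponent q, Finset.mul_sum, map_sum]
  have hcomp : ∀ i, homogeneousComponent (m + n) (p * homogeneousComponent i q)
      = if i = n then p * homogeneousComponent n q else 0 := by
    intro i
    rw [homogeneousComponent_of_mem (hp.mul (homogeneousComponent_isHomogeneous i q))]
    by_cases hi : i = n
    · simp [hi]
    · rw [if_neg hi, if_neg (by omega)]
  simp only [hcomp]
  rw [Finset.sum_ite_eq']
  split_ifs with hn
  · rfl
  · rw [homogeneousComponent_eq_zero, mul_zero]
    simpa using hn

theorem dividedDiff_isHomogeneous (k : Type*) [Field k] [Algebra ℝ k]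
    (b : OrthonormalBasis (Fin ℓ) ℝ E) {α : E} (hα : α ≠ 0) {f : MvPolynomial (Fin ℓ) k} {n : ℕ}
    (hf : f.IsHomogeneous (n + 1)) : (dividedDiff k b α hα f).IsHomogeneous n := by
  refine isHomogeneous_of_mul_left (linForm_isHomogeneous k b α)
    (linForm_ne_zero k b hα) ?_
  rw [linForm_mul_dividedDiff, add_comm]
  exact hf.sub (act_isHomogeneous k b _ hf)

/-! ### Dunkl operators: equivariance and commutativity. -/

section Operators

variable (b : OrthonormalBasis (Fin ℓ) ℝ E) (W : Subgroup (E ≃ₗᵢ[ℝ] E))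

theorem dirDeriv_X (y : E) (i : Fin ℓ) :
    dirDeriv b W y (X i) = C (algebraMap ℝ (ParamField W) (inner ℝ y (b i))) :=
  mkDerivation_X _ _ _

theorem dirDeriv_mul (y : E) (f g : Sc ℓ W) :
    dirDeriv b W y (f * g) = f * dirDeriv b W y g + g * dirDeriv b W y f :=
  Derivation.leibniz (mkDerivation (ParamField W)
    (fun i => (C (algebraMap ℝ (ParamField W) (inner ℝ y (b i))) : Sc ℓ W))) f g

theorem dirDeriv_C (y : E) (r : ParamField W) : dirDeriv b W y (C r) = 0 :=
  mkDerivationₗ_C _ _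

theorem dirDeriv_linForm (y v : E) :
    dirDeriv b W y (linForm _ b v) = C (algebraMap ℝ (ParamField W) (inner ℝ y v)) := by
  rw [linForm, map_sum]
  simp only [dirDeriv_mul, dirDeriv_X, dirDeriv_C, mul_zero, add_zero, ← map_mul, ← map_sum]
  rw [← b.sum_inner_mul_inner]
  simp only [mul_comm]

theorem act_dirDeriv (w : E ≃ₗᵢ[ℝ] E) (y : E) (f : Sc ℓ W) :
    act _ b w (dirDeriv b W y f) = dirDeriv b W (w y) (act _ b w f) := by
  induction f using MvPolynomial.induction_on with
  | C r => rw [act_C, dirDeriv_C, dirDeriv_C, map_zero]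
  | add p q hp hq => simp only [map_add, hp, hq]
  | mul_X p j hp =>
    rw [dirDeriv_mul, map_add, map_mul, map_mul, map_mul, dirDeriv_mul, hp, dirDeriv_X, act_C,
      act_X, dirDeriv_linForm, w.inner_map_map]

theorem dirDeriv_eq_sum_pderiv (y : E) (f : Sc ℓ W) :
    dirDeriv b W y f =
      ∑ i, algebraMap ℝ (ParamField W) (inner ℝ y (b i)) • pderiv i f := by
  induction f using MvPolynomial.induction_on with
  | C r => simp [dirDeriv_C]
  | add p q hp hq => simp only [map_add, hp, hq, smul_add, Finset.sum_add_distrib]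
  | mul_X p j hp =>
    rw [dirDeriv_mul, hp, dirDeriv_X]
    simp only [Derivation.leibniz, smul_add, Finset.sum_add_distrib, smul_eq_mul, pderiv_X]
    simp only [Pi.single_apply, mul_ite, mul_one, mul_zero, smul_ite, smul_zero,
      Finset.sum_ite_eq, Finset.mem_univ, if_true, Finset.mul_sum,
      smul_eq_C_mul]
    rw [mul_comm p]
    congr 1
    refine Finset.sum_congr rfl fun i _ => ?_
    rw [mul_left_comm]

theorem dirDeriv_isHomogeneous (y : E) {f : Sc ℓ W} {n : ℕ} (hf : f.IsHomogeneous (n + 1)) :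
    (dirDeriv b W y f).IsHomogeneous n := by
  rw [dirDeriv_eq_sum_pderiv]
  refine IsHomogeneous.sum _ _ _ fun i _ => ?_
  exact Submodule.smul_mem (homogeneousSubmodule (Fin ℓ) (ParamField W) n) _
    (hf.pderiv (i := i))

theorem dirDeriv_basis (i : Fin ℓ) (f : Sc ℓ W) : dirDeriv b W (b i) f = pderiv i f := by
  rw [dirDeriv_eq_sum_pderiv]
  simp [orthonormal_iff_ite.mp b.orthonormal]

theorem dunklOp_apply [Fintype (Refl W)] (y : E) (f : Sc ℓ W) :
    dunklOp b W y f = dirDeriv b W y f - ∑ s : Refl W,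
      (param W s * algebraMap ℝ (ParamField W) (inner ℝ y (root s))) •
        dividedDiff (ParamField W) b (root s) (root_ne_zero s) f := by
  rw [dunklOp, finsum_eq_sum_of_fintype, LinearMap.sub_apply, LinearMap.sum_apply]
  rfl

/-- The conjugate reflection `w s w⁻¹`. -/
def conjRefl (w : W) : Refl W ≃ Refl W where
  toFun s := ⟨w * s.1 * w⁻¹, by
    obtain ⟨α, hα, h⟩ := s.2
    refine ⟨(w : E ≃ₗᵢ[ℝ] E) α, ?_, ?_⟩
    · simpa using hα
    · rw [← conj_reflectionIn, ← h]; rfl⟩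
  invFun s := ⟨w⁻¹ * s.1 * w, by
    obtain ⟨α, hα, h⟩ := s.2
    refine ⟨((w⁻¹ : W) : E ≃ₗᵢ[ℝ] E) α, ?_, ?_⟩
    · simpa using hα
    · rw [← conj_reflectionIn, ← h]; simp⟩
  left_inv s := Subtype.ext (by simp [mul_assoc])
  right_inv s := Subtype.ext (by simp [mul_assoc])

theorem param_conjRefl (w : W) (s : Refl W) : param W (conjRefl W w s) = param W s := by
  rw [param, param]
  congr 2
  refine Quotient.sound ?_
  exact (isConj_iff.mpr ⟨w, rfl⟩ : IsConj s.1 (conjRefl W w s).1).symm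

/-- The coefficient `c(s) ⟨y, α_s⟩ 2⟨x, α_s⟩ / ⟨α_s, α_s⟩`. -/
def reflCoeff (y x : E) (s : Refl W) : ParamField W :=
  param W s * algebraMap ℝ (ParamField W) (inner ℝ y (root s)) *
    algebraMap ℝ (ParamField W) (2 * inner ℝ (root s) x / inner ℝ (root s) (root s))

/-- Both sides are the same multiple of `⟨y, α_s⟩ ⟨z, α_s⟩ ⟨x, α_s⟩`. This symmetry in `y` and `z`
makes the commutator of two Dunkl operators vanish. -/
theorem reflCoeff_mul_comm (y z x : E) (s : Refl W) :
    reflCoeff W y x s * algebraMap ℝ (ParamField W)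
        (2 * inner ℝ (root s) z / inner ℝ (root s) (root s)) =
      reflCoeff W z x s * algebraMap ℝ (ParamField W)
        (2 * inner ℝ (root s) y / inner ℝ (root s) (root s)) := by
  have h : (inner ℝ y (root s) * (2 * inner ℝ (root s) x / inner ℝ (root s) (root s)) *
      (2 * inner ℝ (root s) z / inner ℝ (root s) (root s)) : ℝ) =
      inner ℝ z (root s) * (2 * inner ℝ (root s) x / inner ℝ (root s) (root s)) *
      (2 * inner ℝ (root s) y / inner ℝ (root s) (root s)) := by
    rw [real_inner_comm y, real_inner_comm z]; ring
  rw [reflCoeff, reflCoeff, mul_assoc, mul_assoc, mul_assoc, mul_assoc, ← map_mul, ← map_mul,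
    ← map_mul, ← map_mul, ← mul_assoc, ← mul_assoc, h]

/-- The commutator of `∇_y` with multiplication by `x`, as in the rational Cherednik algebra: a
constant minus a combination of reflections. -/
theorem dunklOp_linForm_mul [Fintype (Refl W)] (y x : E) (f : Sc ℓ W) :
    dunklOp b W y (linForm _ b x * f) = linForm _ b x * dunklOp b W y f +
      C (algebraMap ℝ (ParamField W) (inner ℝ y x)) * f -
        ∑ s : Refl W, C (reflCoeff W y x s) * act _ b (s : E ≃ₗᵢ[ℝ] E) f := by
  rw [dunklOp_apply, dunklOp_apply, dirDeriv_mul, dirDeriv_linForm]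
  simp only [dividedDiff_linForm_mul, smul_add, Finset.sum_add_distrib, mul_sub, Finset.mul_sum]
  have h1 : ∀ s : Refl W, (param W s * algebraMap ℝ (ParamField W) (inner ℝ y (root s))) •
      (C (algebraMap ℝ (ParamField W)
        (2 * inner ℝ (root s) x / inner ℝ (root s) (root s))) *
          act _ b (reflectionIn (root s)) f) =
      C (reflCoeff W y x s) * act _ b (s : E ≃ₗᵢ[ℝ] E) f := by
    intro s
    rw [eq_reflectionIn_root s, smul_eq_C_mul, reflCoeff, ← mul_assoc, ← C_mul]
  simp only [h1, mul_smul_comm]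
  ring

variable [Finite W]

theorem dunklOp_add_apply (y z : E) (f : Sc ℓ W) :
    dunklOp b W (y + z) f = dunklOp b W y f + dunklOp b W z f := by
  have := Fintype.ofFinite (Refl W)
  simp only [dunklOp_apply, dirDeriv_eq_sum_pderiv, inner_add_left, map_add, mul_add, add_smul,
    Finset.sum_add_distrib]
  abel

theorem dunklOp_smul_apply (r : ℝ) (y : E) (f : Sc ℓ W) :
    dunklOp b W (r • y) f = algebraMap ℝ (ParamField W) r • dunklOp b W y f := by
  have := Fintype.ofFinite (Refl W)
  simp only [dunklOp_apply, dirDeriv_eq_sum_pderiv, inner_smul_left, map_mul, smul_sub,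
    Finset.smul_sum, smul_smul, conj_trivial]
  refine congrArg _ (Finset.sum_congr rfl fun s _ => ?_)
  rw [mul_left_comm]

theorem dunklOp_isHomogeneous (y : E) {f : Sc ℓ W} {n : ℕ} (hf : f.IsHomogeneous (n + 1)) :
    (dunklOp b W y f).IsHomogeneous n := by
  have := Fintype.ofFinite (Refl W)
  rw [dunklOp_apply]
  refine (dirDeriv_isHomogeneous b W y hf).sub (IsHomogeneous.sum _ _ _ fun s _ => ?_)
  exact Submodule.smul_mem (homogeneousSubmodule (Fin ℓ) (ParamField W) n) _
    (dividedDiff_isHomogeneous (ParamField W) b (root_ne_zero s) hf)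

theorem dunklOp_C (y : E) (r : ParamField W) : dunklOp b W y (C r) = 0 := by
  have := Fintype.ofFinite (Refl W)
  simp [dunklOp_apply, dirDeriv_C, dividedDiff_C]

/-- Conjugation by `w` permutes the reflections, preserves `c`, and carries roots to roots up to
scalars, which cancel in `⟨y, α⟩ / α`. -/
theorem act_dunklOp (w : W) (y : E) (f : Sc ℓ W) :
    act _ b (w : E ≃ₗᵢ[ℝ] E) (dunklOp b W y f) =
      dunklOp b W ((w : E ≃ₗᵢ[ℝ] E) y) (act _ b (w : E ≃ₗᵢ[ℝ] E) f) := by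
  have := Fintype.ofFinite (Refl W)
  rw [dunklOp_apply, dunklOp_apply, map_sub, act_dirDeriv, map_sum]
  congr 1
  refine Fintype.sum_equiv (conjRefl W w) _ _ fun s => ?_
  have hw0 : (w : E ≃ₗᵢ[ℝ] E) (root s) ≠ 0 := by simpa using root_ne_zero s
  rw [map_smul, act_dividedDiff _ b _ (root_ne_zero s) hw0, param_conjRefl]
  obtain ⟨r, hr, hr'⟩ := exists_smul_of_reflectionIn_eq (β := (w : E ≃ₗᵢ[ℝ] E) (root s))
    (root_ne_zero (conjRefl W w s)) (by
      rw [← eq_reflectionIn_root, ← conj_reflectionIn, ← eq_reflectionIn_root]; rfl)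
  have hin : (inner ℝ ((w : E ≃ₗᵢ[ℝ] E) y) (root (conjRefl W w s)) : ℝ) =
      r * inner ℝ y (root s) := by
    rw [hr', inner_smul_right, (w : E ≃ₗᵢ[ℝ] E).inner_map_map]
  rw [← dividedDiff_smul_root _ b (root_ne_zero (conjRefl W w s)) hw0 hr hr', smul_smul, hin,
    map_mul, mul_assoc, mul_comm (algebraMap ℝ (ParamField W) r)]

theorem act_dunklOp_refl (s : Refl W) (y : E) (f : Sc ℓ W) :
    act _ b (s : E ≃ₗᵢ[ℝ] E) (dunklOp b W y f) =
      dunklOp b W y (act _ b (s : E ≃ₗᵢ[ℝ] E) f) -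
        C (algebraMap ℝ (ParamField W)
          (2 * inner ℝ (root s) y / inner ℝ (root s) (root s))) *
          dunklOp b W (root s) (act _ b (s : E ≃ₗᵢ[ℝ] E) f) := by
  rw [act_dunklOp b W s.1]
  have h : ((s.1 : W) : E ≃ₗᵢ[ℝ] E) y =
      y + (-(2 * inner ℝ (root s) y / inner ℝ (root s) (root s)) : ℝ) • root s := by
    rw [eq_reflectionIn_root s, reflectionIn_apply, neg_smul, sub_eq_add_neg]
  rw [h, dunklOp_add_apply, dunklOp_smul_apply, map_neg, neg_smul, smul_eq_C_mul, sub_eq_add_neg]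

/-- The commutator of `∇_y` and `∇_z` kills constants, and it commutes with multiplication by a
vector `x`. Indeed, expanding both orders on `x f` and moving each `s` past the Dunkl operators
leaves, besides terms visibly symmetric in `y` and `z`, only multiples of `∇_{α_s} s f`, whose
coefficients are symmetric by `reflCoeff_mul_comm`. -/
theorem dunklOp_comm_apply (y z : E) (f : Sc ℓ W) :
    dunklOp b W y (dunklOp b W z f) = dunklOp b W z (dunklOp b W y f) := by
  have := Fintype.ofFinite (Refl W)
  induction f using MvPolynomial.induction_on with
  | C r => simp [dunklOp_C]
  | add p q hp hq => simp only [map_add, hp, hq]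
  | mul_X p j hp =>
    have hC : ∀ (v : E) (r : ParamField W) (g : Sc ℓ W),
        dunklOp b W v (C r * g) = C r * dunklOp b W v g := fun v r g => by
      rw [← smul_eq_C_mul, map_smul, smul_eq_C_mul]
    rw [mul_comm, ← linForm_basis _ b j]
    simp only [dunklOp_linForm_mul, map_add, map_sub, map_sum, hC, act_dunklOp_refl, mul_sub,
      Finset.sum_sub_distrib]
    rw [hp]
    have h : ∀ s : Refl W, C (reflCoeff W y (b j) s) * (C (algebraMap ℝ (ParamField W)
          (2 * inner ℝ (root s) z / inner ℝ (root s) (root s))) *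
          dunklOp b W (root s) (act _ b (s : E ≃ₗᵢ[ℝ] E) p)) =
        C (reflCoeff W z (b j) s) * (C (algebraMap ℝ (ParamField W)
          (2 * inner ℝ (root s) y / inner ℝ (root s) (root s))) *
          dunklOp b W (root s) (act _ b (s : E ≃ₗᵢ[ℝ] E) p)) := by
      intro s
      rw [← mul_assoc, ← mul_assoc, ← C_mul, ← C_mul, reflCoeff_mul_comm]
    simp only [h]
    ring

theorem dunklOp_comm (y z : E) : dunklOp b W y * dunklOp b W z = dunklOp b W z * dunklOp b W y :=
  LinearMap.ext fun f => dunklOp_comm_apply b W y z f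

end Operators

/-- Substitution of commuting elements for the variables is an algebra homomorphism. -/
theorem exists_algHom_of_commute {k A : Type*} [CommRing k] [Ring A] [Algebra k A]
    (T : Fin ℓ → A) (hT : ∀ i j, T i * T j = T j * T i) :
    ∃ Φ : MvPolynomial (Fin ℓ) k →ₐ[k] A,
      (∀ p, Φ p = ∑ m ∈ p.support, p.coeff m • (List.ofFn fun i => T i ^ m i).prod) ∧
        ∀ i, Φ (X i) = T i := by
  -- Evaluation needs a commutative target, so it is done in the subalgebra generated by the `T i`.
  have hcomm := Algebra.isMulCommutative_adjoin k (s := Set.range T) (by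
    rintro _ ⟨i, rfl⟩ _ ⟨j, rfl⟩
    exact hT i j)
  let _ : CommRing (Algebra.adjoin k (Set.range T)) :=
    { (inferInstance : Ring (Algebra.adjoin k (Set.range T))) with
      mul_comm := hcomm.is_comm.comm }
  let t : Fin ℓ → Algebra.adjoin k (Set.range T) :=
    fun i => ⟨T i, Algebra.subset_adjoin ⟨i, rfl⟩⟩
  refine ⟨(Algebra.adjoin k (Set.range T)).val.comp (aeval t), fun p => ?_, fun i => ?_⟩
  · rw [AlgHom.comp_apply, aeval_def, eval₂_eq', map_sum]
    refine Finset.sum_congr rfl fun m _ => ?_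
    rw [← Algebra.smul_def, map_smul, ← List.prod_ofFn, map_list_prod, List.map_ofFn]
    rfl
  · rw [AlgHom.comp_apply, aeval_X]
    rfl

/-! ### The operators `∇_p`, the form, and the grading. -/

section Operators

variable (b : OrthonormalBasis (Fin ℓ) ℝ E) (W : Subgroup (E ≃ₗᵢ[ℝ] E)) [Finite W]

theorem exists_algHom_eq_dunklPoly :
    ∃ Φ : Sc ℓ W →ₐ[ParamField W] Module.End (ParamField W) (Sc ℓ W),
      (∀ p, Φ p = dunklPoly b W p) ∧ ∀ i, Φ (X i) = dunklOp b W (b i) :=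
  exists_algHom_of_commute (fun i => dunklOp b W (b i)) fun i j => dunklOp_comm b W (b i) (b j)

theorem dunklPoly_add (p q : Sc ℓ W) :
    dunklPoly b W (p + q) = dunklPoly b W p + dunklPoly b W q := by
  obtain ⟨Φ, h, -⟩ := exists_algHom_eq_dunklPoly b W
  rw [← h, ← h, ← h, map_add]

theorem dunklPoly_mul (p q : Sc ℓ W) :
    dunklPoly b W (p * q) = dunklPoly b W p * dunklPoly b W q := by
  obtain ⟨Φ, h, -⟩ := exists_algHom_eq_dunklPoly b W
  rw [← h, ← h, ← h, map_mul]

theorem dunklPoly_smul (r : ParamField W) (p : Sc ℓ W) :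
    dunklPoly b W (r • p) = r • dunklPoly b W p := by
  obtain ⟨Φ, h, -⟩ := exists_algHom_eq_dunklPoly b W
  rw [← h, ← h, map_smul]

theorem dunklPoly_C (r : ParamField W) (f : Sc ℓ W) : dunklPoly b W (C r) f = r • f := by
  obtain ⟨Φ, h, -⟩ := exists_algHom_eq_dunklPoly b W
  have : Φ (C r) = algebraMap _ _ r := Φ.commutes r
  rw [← h, this]
  rfl

theorem dunklPoly_X (i : Fin ℓ) : dunklPoly b W (X i) = dunklOp b W (b i) := by
  obtain ⟨Φ, h, h'⟩ := exists_algHom_eq_dunklPoly b W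
  rw [← h, h']

/-- `p ↦ ∇_p` as a linear map. -/
def dunklPolyLin : Sc ℓ W →ₗ[ParamField W] Module.End (ParamField W) (Sc ℓ W) where
  toFun := dunklPoly b W
  map_add' := dunklPoly_add b W
  map_smul' := dunklPoly_smul b W

/-- The form `(f, g)_c` as a bilinear map. -/
def dunklBilin : Sc ℓ W →ₗ[ParamField W] Sc ℓ W →ₗ[ParamField W] ParamField W :=
  LinearMap.compRight (ParamField W) (lcoeff (ParamField W) 0) ∘ₗ dunklPolyLin b W

theorem dunklBilin_apply (f g : Sc ℓ W) : dunklBilin b W f g = dunklForm b W f g := rfl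

/-- Multiplication by `q` is adjoint to `∇_q`; this links Dunkl equations with orthogonality. -/
theorem dunklForm_mul (p q f : Sc ℓ W) :
    dunklForm b W (p * q) f = dunklForm b W p (dunklPoly b W q f) := by
  rw [dunklForm, dunklPoly_mul, dunklForm]
  rfl

theorem dunklPoly_linForm (v : E) : dunklPoly b W (linForm _ b v) = dunklOp b W v := by
  refine LinearMap.ext fun f => ?_
  have h1 : ∀ t : Finset (Fin ℓ), dunklOp b W (∑ i ∈ t, b.repr v i • b i) f =
      ∑ i ∈ t, algebraMap ℝ (ParamField W) (b.repr v i) • dunklOp b W (b i) f := by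
    intro t
    classical
    induction t using Finset.induction_on with
    | empty =>
      rw [Finset.sum_empty, Finset.sum_empty, ← zero_smul ℝ (0 : E), dunklOp_smul_apply, map_zero,
        zero_smul]
    | insert i t hi ih =>
      rw [Finset.sum_insert hi, Finset.sum_insert hi, dunklOp_add_apply, dunklOp_smul_apply, ih]
  conv_rhs => rw [← b.sum_repr v, h1]
  change (dunklPolyLin b W _) f = _
  rw [linForm, map_sum, LinearMap.sum_apply]
  refine Finset.sum_congr rfl fun i _ => ?_
  rw [← smul_eq_C_mul, map_smul, b.repr_apply_apply, LinearMap.smul_apply]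
  exact congrArg _ (congrArg (fun T => T f) (dunklPoly_X b W i))

theorem act_dunklPoly (w : W) (p f : Sc ℓ W) :
    act _ b (w : E ≃ₗᵢ[ℝ] E) (dunklPoly b W p f) =
      dunklPoly b W (act _ b (w : E ≃ₗᵢ[ℝ] E) p) (act _ b (w : E ≃ₗᵢ[ℝ] E) f) := by
  induction p using MvPolynomial.induction_on generalizing f with
  | C r => rw [act_C, dunklPoly_C, dunklPoly_C, map_smul]
  | add p q hp hq =>
    rw [map_add, dunklPoly_add, dunklPoly_add, LinearMap.add_apply, LinearMap.add_apply, map_add,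
      hp, hq]
  | mul_X p j hp =>
    rw [map_mul, dunklPoly_mul, dunklPoly_mul, act_X, dunklPoly_X, dunklPoly_linForm,
      Module.End.mul_apply, Module.End.mul_apply, hp, act_dunklOp]

/-- Thanks to this, nondegeneracy of the form on invariants alone suffices to show that `∇_p f`
vanishes. -/
theorem dunklPoly_mem_invariants {p f : Sc ℓ W} (hp : p ∈ invariants (ParamField W) b W)
    (hf : f ∈ invariants (ParamField W) b W) :
    dunklPoly b W p f ∈ invariants (ParamField W) b W := fun w hw => by
  rw [act_dunklPoly b W ⟨w, hw⟩, hp w hw, hf w hw]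

theorem dunklOp_eq_zero_of_isHomogeneous_zero (y : E) {f : Sc ℓ W} (hf : f.IsHomogeneous 0) :
    dunklOp b W y f = 0 := by
  rw [← totalDegree_zero_iff_isHomogeneous] at hf
  rw [totalDegree_eq_zero_iff_eq_C.mp hf, dunklOp_C]

/-- `∇_p` lowers the degree by `d`. -/
def LowersDegree (d : ℕ) (p : Sc ℓ W) : Prop :=
  (∀ n f, f.IsHomogeneous (n + d) → (dunklPoly b W p f).IsHomogeneous n) ∧
    ∀ n f, n < d → f.IsHomogeneous n → dunklPoly b W p f = 0

variable {b W} in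
theorem LowersDegree.mul {d d' : ℕ} {p q : Sc ℓ W} (hp : LowersDegree b W d p)
    (hq : LowersDegree b W d' q) : LowersDegree b W (d + d') (p * q) := by
  refine ⟨fun n f hf => ?_, fun n f hn hf => ?_⟩
  · rw [dunklPoly_mul, Module.End.mul_apply]
    exact hp.1 _ _ (hq.1 _ _ (by rwa [add_assoc]))
  · rw [dunklPoly_mul, Module.End.mul_apply]
    by_cases h : n < d'
    · rw [hq.2 n f h hf, map_zero]
    · refine hp.2 (n - d') _ (by omega) (hq.1 _ _ ?_)
      rwa [Nat.sub_add_cancel (by omega)]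

theorem lowersDegree_C (r : ParamField W) : LowersDegree b W 0 (C r) := by
  refine ⟨fun n f hf => ?_, fun n f hn => absurd hn (Nat.not_lt_zero n)⟩
  rw [dunklPoly_C]
  exact Submodule.smul_mem (homogeneousSubmodule (Fin ℓ) (ParamField W) n) _ hf

theorem lowersDegree_X (i : Fin ℓ) : LowersDegree b W 1 (X i) := by
  refine ⟨fun n f hf => ?_, fun n f hn hf => ?_⟩
  · rw [dunklPoly_X]
    exact dunklOp_isHomogeneous b W _ hf
  · rw [dunklPoly_X]
    obtain rfl : n = 0 := by omega
    exact dunklOp_eq_zero_of_isHomogeneous_zero b W _ hf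

theorem lowersDegree_monomial (m : Fin ℓ →₀ ℕ) (r : ParamField W) :
    LowersDegree b W m.degree (monomial m r) := by
  have hpow : ∀ (i : Fin ℓ) (e : ℕ), LowersDegree b W e (X i ^ e) := by
    intro i e
    induction e with
    | zero => exact lowersDegree_C b W 1
    | succ e ih => exact pow_succ (X i : Sc ℓ W) e ▸ ih.mul (lowersDegree_X b W i)
  have hprod : ∀ t : Finset (Fin ℓ), LowersDegree b W (∑ i ∈ t, m i) (∏ i ∈ t, X i ^ m i) := by
    intro t
    classical
    induction t using Finset.induction_on with
    | empty => exact lowersDegree_C b W 1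
    | insert i t hi ih =>
      rw [Finset.sum_insert hi, Finset.prod_insert hi]
      exact (hpow i (m i)).mul ih
  rw [monomial_eq, ← zero_add m.degree]
  exact (lowersDegree_C b W r).mul (hprod _)

theorem lowersDegree_of_isHomogeneous {d : ℕ} {p : Sc ℓ W} (hp : p.IsHomogeneous d) :
    LowersDegree b W d p := by
  have hm : ∀ m ∈ p.support, LowersDegree b W d (monomial m (p.coeff m)) := fun m hm => by
    have hd : d = m.degree := hp.degree_eq_sum_deg_support hm
    rw [hd]
    exact lowersDegree_monomial b W m _
  have hsum : ∀ f, dunklPoly b W p f =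
      ∑ m ∈ p.support, dunklPoly b W (monomial m (p.coeff m)) f := fun f => by
    conv_lhs => rw [p.as_sum]
    change dunklPolyLin b W _ f = _
    rw [map_sum, LinearMap.sum_apply]
    rfl
  refine ⟨fun n f hf => ?_, fun n f hn hf => ?_⟩
  · rw [hsum]
    exact IsHomogeneous.sum _ _ _ fun m h => (hm m h).1 n f hf
  · rw [hsum]
    exact Finset.sum_eq_zero fun m h => (hm m h).2 n f hn hf

theorem dunklForm_eq_zero_of_degree_ne {m n : ℕ} {p f : Sc ℓ W} (hp : p.IsHomogeneous m)
    (hf : f.IsHomogeneous n) (h : m ≠ n) : dunklForm b W p f = 0 := by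
  rcases lt_or_gt_of_ne h with h | h
  · have := (lowersDegree_of_isHomogeneous b W hp).1 (n - m) f
      (by rwa [Nat.sub_add_cancel h.le])
    rw [dunklForm, constantCoeff_eq]
    refine this.coeff_eq_zero ?_
    rw [map_zero]
    omega
  · rw [dunklForm, (lowersDegree_of_isHomogeneous b W hp).2 n f h hf, map_zero]

end Operators

/-! ### The form at `c = 0`, given by partial derivatives. -/

section Pairing

/-- Substituting partial derivatives for the variables is an algebra homomorphism. -/
theorem exists_algHom_pderiv (k : Type*) [CommRing k] (ℓ : ℕ) :
    ∃ Φ : MvPolynomial (Fin ℓ) k →ₐ[k] Module.End k (MvPolynomial (Fin ℓ) k),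
      ∀ i, Φ (X i) = (pderiv i).toLinearMap := by
  obtain ⟨Φ, -, h⟩ := exists_algHom_of_commute (k := k) (ℓ := ℓ)
    (A := Module.End k (MvPolynomial (Fin ℓ) k)) (fun i => (pderiv i).toLinearMap) fun i j => by
      refine LinearMap.ext fun f => MvPolynomial.ext _ _ fun m => ?_
      change coeff m (pderiv i (pderiv j f)) = coeff m (pderiv j (pderiv i f))
      simp only [coeff_pderiv, add_right_comm m (Finsupp.single i 1), Finsupp.add_apply,
        Finsupp.single_apply]
      by_cases hij : i = j
      · rw [hij]
      · rw [if_neg hij, if_neg (Ne.symm hij), add_zero, add_zero, mul_right_comm]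
  exact ⟨Φ, h⟩

/-- The operator obtained from a polynomial by substituting partial derivatives for the
variables. -/
def diffPoly (k : Type*) [CommRing k] (ℓ : ℕ) :
    MvPolynomial (Fin ℓ) k →ₐ[k] Module.End k (MvPolynomial (Fin ℓ) k) :=
  (exists_algHom_pderiv k ℓ).choose

theorem diffPoly_X_apply (k : Type*) [CommRing k] (i : Fin ℓ) (f : MvPolynomial (Fin ℓ) k) :
    diffPoly k ℓ (X i) f = pderiv i f := by
  rw [diffPoly, (exists_algHom_pderiv k ℓ).choose_spec]
  rfl

/-- The factor `r` is a product of exponents brought down by differentiation; only its positivity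
and its independence of `g` matter. -/
theorem coeff_diffPoly_monomial (k : Type*) [CommRing k] (m n : Fin ℓ →₀ ℕ) :
    ∃ r : ℕ, 0 < r ∧
      ∀ g, coeff n (diffPoly k ℓ (monomial m 1) g) = r * coeff (n + m) g := by
  induction m using Finsupp.induction_linear generalizing n with
  | zero =>
    refine ⟨1, one_pos, fun g => ?_⟩
    have : diffPoly k ℓ (monomial 0 1) = 1 := map_one _
    rw [this, Module.End.one_apply, add_zero, Nat.cast_one, one_mul]
  | add m m' hm hm' =>
    obtain ⟨r, hr, h⟩ := hm n
    obtain ⟨r', hr', h'⟩ := hm' (n + m)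
    refine ⟨r * r', Nat.mul_pos hr hr', fun g => ?_⟩
    have : (monomial (m + m') 1 : MvPolynomial (Fin ℓ) k) = monomial m 1 * monomial m' 1 := by
      rw [monomial_mul, one_mul]
    rw [this, map_mul, Module.End.mul_apply, h, h', add_assoc, Nat.cast_mul, mul_assoc]
  | single i e =>
    induction e generalizing n with
    | zero =>
      refine ⟨1, one_pos, fun g => ?_⟩
      have : diffPoly k ℓ (monomial (Finsupp.single i 0) 1) = 1 := by
        rw [Finsupp.single_zero]; exact map_one _
      rw [this, Module.End.one_apply, Finsupp.single_zero, add_zero, Nat.cast_one, one_mul]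
    | succ e ih =>
      obtain ⟨r, hr, h⟩ := ih n
      refine ⟨r * ((n + Finsupp.single i e : Fin ℓ →₀ ℕ) i + 1), by positivity, fun g => ?_⟩
      have : (monomial (Finsupp.single i (e + 1)) 1 : MvPolynomial (Fin ℓ) k) =
          monomial (Finsupp.single i e) 1 * X i := by
        rw [X, monomial_mul, one_mul, Finsupp.single_add]
      rw [this, map_mul, Module.End.mul_apply, h, diffPoly_X_apply, coeff_pderiv,
        Finsupp.single_add, add_assoc n, Nat.cast_mul, Nat.cast_add, Nat.cast_one, mul_assoc,
        mul_comm (coeff _ g)]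

/-- Complex conjugation of the coefficients. -/
def conjPoly (ℓ : ℕ) : MvPolynomial (Fin ℓ) ℂ →+* MvPolynomial (Fin ℓ) ℂ :=
  MvPolynomial.map (starRingEnd ℂ)

theorem conjPoly_smul (z : ℂ) (f : MvPolynomial (Fin ℓ) ℂ) :
    conjPoly ℓ (z • f) = starRingEnd ℂ z • conjPoly ℓ f := by
  rw [smul_eq_C_mul, map_mul, conjPoly, map_C, smul_eq_C_mul]

/-- Distinct monomials are orthogonal and each has positive square, so the value is a positive
combination of the `|g_m|²`. Without conjugation the bilinear form may have isotropic vectors. -/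
theorem constantCoeff_diffPoly_conj_ne_zero {g : MvPolynomial (Fin ℓ) ℂ} (hg : g ≠ 0) :
    constantCoeff (diffPoly ℂ ℓ (conjPoly ℓ g) g) ≠ 0 := by
  choose r hr h using fun m => coeff_diffPoly_monomial (ℓ := ℓ) ℂ m 0
  have hsum : constantCoeff (diffPoly ℂ ℓ (conjPoly ℓ g) g) =
      ((∑ m ∈ (conjPoly ℓ g).support, r m * Complex.normSq (coeff m g) : ℝ) : ℂ) := by
    conv_lhs => rw [(conjPoly ℓ g).as_sum, map_sum, LinearMap.sum_apply, map_sum]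
    rw [Complex.ofReal_sum]
    refine Finset.sum_congr rfl fun m _ => ?_
    have h1 : monomial m (coeff m (conjPoly ℓ g)) =
        starRingEnd ℂ (coeff m g) • monomial m (1 : ℂ) := by
      rw [smul_monomial, smul_eq_mul, mul_one, conjPoly, coeff_map]
    rw [h1, map_smul, LinearMap.smul_apply, constantCoeff_eq, coeff_smul, h, zero_add, smul_eq_mul,
      mul_left_comm, mul_comm (starRingEnd ℂ _), Complex.mul_conj, Complex.ofReal_mul]
    simp
  rw [hsum, Complex.ofReal_ne_zero]
  refine (Finset.sum_pos (fun m hm => ?_) ?_).ne'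
  · have : coeff m g ≠ 0 := by
      have := mem_support_iff.mp hm
      rw [conjPoly, coeff_map] at this
      exact fun h0 => this (by rw [h0, map_zero])
    exact mul_pos (Nat.cast_pos.mpr (hr m)) (Complex.normSq_pos.mpr this)
  · rw [Finset.nonempty_iff_ne_empty, Ne, support_eq_empty, conjPoly]
    exact fun h0 => hg (map_injective _ (starRingEnd ℂ).injective (by rw [h0, map_zero]))

end Pairing

/-! ### Specialization at `c = 0` and nondegeneracy. -/

section Specialization

variable (b : OrthonormalBasis (Fin ℓ) ℝ E) (W : Subgroup (E ≃ₗᵢ[ℝ] E))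

/-- `f` has coefficients in `ℂ[c]`, and its value at `c = 0` is `g`. -/
def Specializes (f : Sc ℓ W) (g : MvPolynomial (Fin ℓ) ℂ) : Prop :=
  ∃ F : MvPolynomial (Fin ℓ) (MvPolynomial (ReflClass W) ℂ),
    map (algebraMap _ (ParamField W)) F = f ∧ map constantCoeff F = g

variable {W}

theorem Specializes.add {f f' : Sc ℓ W} {g g' : MvPolynomial (Fin ℓ) ℂ}
    (h : Specializes W f g) (h' : Specializes W f' g') : Specializes W (f + f') (g + g') := by
  obtain ⟨F, rfl, rfl⟩ := h
  obtain ⟨F', rfl, rfl⟩ := h'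
  exact ⟨F + F', map_add _ _ _, map_add _ _ _⟩

theorem Specializes.sub {f f' : Sc ℓ W} {g g' : MvPolynomial (Fin ℓ) ℂ}
    (h : Specializes W f g) (h' : Specializes W f' g') : Specializes W (f - f') (g - g') := by
  obtain ⟨F, rfl, rfl⟩ := h
  obtain ⟨F', rfl, rfl⟩ := h'
  exact ⟨F - F', map_sub _ _ _, map_sub _ _ _⟩

theorem Specializes.smul {f : Sc ℓ W} {g : MvPolynomial (Fin ℓ) ℂ} (h : Specializes W f g)
    (a : MvPolynomial (ReflClass W) ℂ) :
    Specializes W (algebraMap _ (ParamField W) a • f) (constantCoeff a • g) := by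
  obtain ⟨F, rfl, rfl⟩ := h
  refine ⟨C a * F, ?_, ?_⟩
  · rw [map_mul, map_C, smul_eq_C_mul]
  · rw [map_mul, map_C, smul_eq_C_mul]

theorem specializes_zero : Specializes W (0 : Sc ℓ W) 0 := ⟨0, map_zero _, map_zero _⟩

theorem algebraMap_C_eq (z : ℂ) :
    algebraMap (MvPolynomial (ReflClass W) ℂ) (ParamField W) (C z) =
      algebraMap ℂ (ParamField W) z :=
  (IsScalarTower.algebraMap_apply ℂ (MvPolynomial (ReflClass W) ℂ) (ParamField W) z).symm

theorem algebraMap_real_eq (r : ℝ) :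
    algebraMap ℝ (ParamField W) r = algebraMap ℂ (ParamField W) r :=
  IsScalarTower.algebraMap_apply ℝ ℂ (ParamField W) r

theorem specializes_toSc (g : MvPolynomial (Fin ℓ) ℂ) : Specializes W (toSc ℓ W g) g := by
  refine ⟨map C g, ?_, ?_⟩
  · rw [map_map, toSc]
    congr 2
  · rw [map_map]
    have : (constantCoeff : MvPolynomial (ReflClass W) ℂ →+* ℂ).comp C = RingHom.id ℂ :=
      RingHom.ext fun z => constantCoeff_C _ z
    rw [this, map_id]

theorem toSc_C (z : ℂ) : toSc ℓ W (C z) = C (algebraMap ℂ (ParamField W) z) :=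
  map_C _ _

theorem toSc_X (i : Fin ℓ) : toSc ℓ W (X i) = X i := map_X _ _

theorem toSc_smul (z : ℂ) (g : MvPolynomial (Fin ℓ) ℂ) :
    toSc ℓ W (z • g) = algebraMap ℂ (ParamField W) z • toSc ℓ W g := by
  rw [smul_eq_C_mul, map_mul, toSc_C, smul_eq_C_mul]

theorem toSc_linForm (v : E) : toSc ℓ W (linForm ℂ b v) = linForm (ParamField W) b v := by
  rw [linForm, linForm, map_sum]
  refine Finset.sum_congr rfl fun i _ => ?_
  rw [map_mul, toSc_C, toSc_X, algebraMap_real_eq]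
  rfl

theorem toSc_act (w : E ≃ₗᵢ[ℝ] E) (g : MvPolynomial (Fin ℓ) ℂ) :
    toSc ℓ W (act ℂ b w g) = act (ParamField W) b w (toSc ℓ W g) := by
  induction g using MvPolynomial.induction_on with
  | C r => rw [act_C, toSc_C, act_C]
  | add p q hp hq => simp only [map_add, hp, hq]
  | mul_X p j hp => rw [map_mul, map_mul, map_mul, map_mul, hp, act_X, toSc_X, act_X, toSc_linForm]

theorem toSc_dividedDiff {α : E} (hα : α ≠ 0) (g : MvPolynomial (Fin ℓ) ℂ) :
    dividedDiff (ParamField W) b α hα (toSc ℓ W g) = toSc ℓ W (dividedDiff ℂ b α hα g) := by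
  refine dividedDiff_eq _ b hα ?_
  rw [← toSc_linForm, ← map_mul, linForm_mul_dividedDiff, map_sub, toSc_act]

theorem toSc_pderiv (i : Fin ℓ) (g : MvPolynomial (Fin ℓ) ℂ) :
    pderiv i (toSc ℓ W g) = toSc ℓ W (pderiv i g) := pderiv_map

variable [Finite W]

/-- On complex polynomials divided differences have complex values, so each reflection term carries
the factor `c(s)` and disappears at `c = 0`. Linearity over `ℂ[c]` does the rest. -/
theorem Specializes.dunklOp {f : Sc ℓ W} {g : MvPolynomial (Fin ℓ) ℂ} (h : Specializes W f g)
    (i : Fin ℓ) : Specializes W (dunklOp b W (b i) f) (pderiv i g) := by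
  have := Fintype.ofFinite (Refl W)
  have key : ∀ g : MvPolynomial (Fin ℓ) ℂ,
      Specializes W (Dunkl.dunklOp b W (b i) (toSc ℓ W g)) (pderiv i g) := by
    intro g
    rw [dunklOp_apply, dirDeriv_basis, toSc_pderiv]
    suffices h : Specializes W (∑ s : Refl W,
        (param W s * algebraMap ℝ (ParamField W) (inner ℝ (b i) (root s))) •
          dividedDiff (ParamField W) b (root s) (root_ne_zero s) (toSc ℓ W g)) 0 by
      simpa only [sub_zero] using (specializes_toSc (W := W) (pderiv i g)).sub h
    refine Finset.sum_induction (M := Sc ℓ W) _ (fun f => Specializes W f 0)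
      (fun f f' h h' => by simpa using h.add h') specializes_zero fun s _ => ?_
    rw [algebraMap_real_eq, ← algebraMap_C_eq, param, ← map_mul, toSc_dividedDiff]
    have h := (specializes_toSc (W := W) (dividedDiff ℂ b (root s) (root_ne_zero s) g)).smul
      (X (Quotient.mk _ s) * C ((inner ℝ (b i) (root s) : ℝ) : ℂ))
    rwa [map_mul constantCoeff, constantCoeff_X, zero_mul, zero_smul] at h
  obtain ⟨F, rfl, rfl⟩ := h
  induction F using MvPolynomial.induction_on' with
  | monomial m a =>
    have h1 : map (algebraMap _ (ParamField W)) (monomial m a) =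
        algebraMap (MvPolynomial (ReflClass W) ℂ) (ParamField W) a • toSc ℓ W (monomial m 1) := by
      rw [map_monomial, toSc, map_monomial, map_one, smul_monomial, smul_eq_mul, mul_one]
    have h2 : map constantCoeff (monomial m a) =
        constantCoeff a • monomial (R := ℂ) m 1 := by
      rw [map_monomial, smul_monomial, smul_eq_mul, mul_one]
    rw [h1, h2, map_smul, Derivation.map_smul]
    exact (key _).smul a
  | add F F' hF hF' =>
    simp only [map_add]
    exact hF.add hF'

theorem Specializes.dunklPoly (p : MvPolynomial (Fin ℓ) ℂ) {f : Sc ℓ W}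
    {g : MvPolynomial (Fin ℓ) ℂ} (h : Specializes W f g) :
    Specializes W (dunklPoly b W (toSc ℓ W p) f) (diffPoly ℂ ℓ p g) := by
  induction p using MvPolynomial.induction_on generalizing f g with
  | C z =>
    have : diffPoly ℂ ℓ (C z) = algebraMap ℂ _ z := (diffPoly ℂ ℓ).commutes z
    rw [this, toSc_C, dunklPoly_C, Module.algebraMap_end_apply, ← algebraMap_C_eq]
    simpa using h.smul (C z)
  | add p q hp hq =>
    rw [map_add, map_add, dunklPoly_add]
    exact (hp h).add (hq h)
  | mul_X p j hp =>
    rw [map_mul, map_mul, dunklPoly_mul, toSc_X, dunklPoly_X, Module.End.mul_apply,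
      Module.End.mul_apply, diffPoly_X_apply]
    exact hp (h.dunklOp b j)

theorem exists_dunklForm_toSc (p g : MvPolynomial (Fin ℓ) ℂ) :
    ∃ a : MvPolynomial (ReflClass W) ℂ,
      algebraMap _ (ParamField W) a = dunklForm b W (toSc ℓ W p) (toSc ℓ W g) ∧
        constantCoeff a = constantCoeff (diffPoly ℂ ℓ p g) := by
  obtain ⟨F, h1, h2⟩ := (specializes_toSc (W := W) g).dunklPoly b p
  refine ⟨constantCoeff F, ?_, ?_⟩
  · rw [dunklForm, ← h1, constantCoeff_map]
  · rw [← h2, constantCoeff_map]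

variable {ι : Type*} [Fintype ι] {v : ι → MvPolynomial (Fin ℓ) ℂ}

/-- The Gram determinant lies in `ℂ[c]`, so its value at `c = 0` is enough. There a kernel vector
would give a nonzero `g` in the complex span orthogonal to that whole span, hence to its own
conjugate. -/
theorem det_dunklForm_ne_zero [DecidableEq ι] (hv : LinearIndependent ℂ v)
    (hconj : ∀ i, conjPoly ℓ (v i) ∈ Submodule.span ℂ (Set.range v)) :
    (Matrix.of fun i j => dunklForm b W (toSc ℓ W (v i)) (toSc ℓ W (v j))).det ≠ 0 := by
  choose a ha ha0 using fun i j => exists_dunklForm_toSc b (W := W) (v i) (v j)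
  have h1 : (Matrix.of fun i j => dunklForm b W (toSc ℓ W (v i)) (toSc ℓ W (v j))) =
      (algebraMap _ (ParamField W)).mapMatrix (Matrix.of a) :=
    Matrix.ext fun i j => (ha i j).symm
  rw [h1, ← RingHom.map_det]
  intro h0
  have h2 : (Matrix.of a).det = 0 :=
    (IsFractionRing.injective (MvPolynomial (ReflClass W) ℂ) (ParamField W))
      (by rw [h0, map_zero])
  have h3 := congrArg constantCoeff h2
  rw [RingHom.map_det, map_zero, ← Matrix.exists_mulVec_eq_zero_iff] at h3
  obtain ⟨x, hx, hx0⟩ := h3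
  set g := ∑ j, x j • v j with hg
  have hg0 : g ≠ 0 := fun h => hx (funext fun i =>
    (Fintype.linearIndependent_iff.mp hv) x h i)
  have horth : ∀ i, constantCoeff (diffPoly ℂ ℓ (v i) g) = 0 := by
    intro i
    rw [hg, map_sum, map_sum]
    have := congrFun hx0 i
    simp only [Matrix.mulVec, dotProduct, RingHom.mapMatrix_apply, Matrix.map_apply,
      Matrix.of_apply, ha0, Pi.zero_apply] at this
    rw [← this]
    refine Finset.sum_congr rfl fun j _ => ?_
    rw [map_smul, constantCoeff_smul, smul_eq_mul, mul_comm]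
  have hspan : ∀ p ∈ Submodule.span ℂ (Set.range v), constantCoeff (diffPoly ℂ ℓ p g) = 0 := by
    intro p hp
    induction hp using Submodule.span_induction with
    | mem p hp => obtain ⟨i, rfl⟩ := hp; exact horth i
    | zero => simp
    | add p q _ _ hp hq => rw [map_add, LinearMap.add_apply, map_add, hp, hq, add_zero]
    | smul z p _ hp => rw [map_smul, LinearMap.smul_apply, constantCoeff_smul, hp, smul_zero]
  refine constantCoeff_diffPoly_conj_ne_zero hg0 (hspan _ ?_)
  rw [hg, map_sum]
  exact Submodule.sum_mem _ fun j _ => by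
    rw [conjPoly_smul]; exact Submodule.smul_mem _ _ (hconj j)

/-- Orthogonal projection onto the span: its coordinates are obtained by inverting the Gram matrix.
-/
theorem exists_orthogonal_of_conj (hv : LinearIndependent ℂ v)
    (hconj : ∀ i, conjPoly ℓ (v i) ∈ Submodule.span ℂ (Set.range v)) (g : Sc ℓ W) :
    ∃ x ∈ Submodule.span (ParamField W) (Set.range fun i => toSc ℓ W (v i)),
      ∀ i, dunklForm b W (toSc ℓ W (v i)) (g - x) = 0 := by
  classical
  set G := Matrix.of fun i j => dunklForm b W (toSc ℓ W (v i)) (toSc ℓ W (v j)) with hG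
  have hdet : IsUnit G.det := (det_dunklForm_ne_zero b hv hconj).isUnit
  set x := G⁻¹.mulVec fun i => dunklForm b W (toSc ℓ W (v i)) g with hx
  refine ⟨∑ j, x j • toSc ℓ W (v j), Submodule.sum_mem _ fun j _ =>
    Submodule.smul_mem _ _ (Submodule.subset_span ⟨j, rfl⟩), fun i => ?_⟩
  have h1 : G.mulVec x = fun i => dunklForm b W (toSc ℓ W (v i)) g := by
    rw [hx, Matrix.mulVec_mulVec, Matrix.mul_nonsing_inv _ hdet, Matrix.one_mulVec]
  have h2 := congrFun h1 i
  rw [← dunklBilin_apply, map_sub, map_sum, sub_eq_zero, dunklBilin_apply, ← h2]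
  refine Finset.sum_congr rfl fun j _ => ?_
  rw [map_smul, smul_eq_mul, mul_comm, dunklBilin_apply]
  rfl

theorem eq_zero_of_dunklForm_eq_zero (hv : LinearIndependent ℂ v)
    (hconj : ∀ i, conjPoly ℓ (v i) ∈ Submodule.span ℂ (Set.range v)) {g : Sc ℓ W}
    (hg : g ∈ Submodule.span (ParamField W) (Set.range fun i => toSc ℓ W (v i)))
    (h : ∀ i, dunklForm b W (toSc ℓ W (v i)) g = 0) : g = 0 := by
  classical
  obtain ⟨x, rfl⟩ := (Submodule.mem_span_range_iff_exists_fun _).mp hg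
  have hx : x = 0 := by
    refine Matrix.eq_zero_of_mulVec_eq_zero (det_dunklForm_ne_zero b hv hconj)
      (funext fun i => ?_)
    rw [Pi.zero_apply, ← h i, ← dunklBilin_apply, map_sum]
    refine Finset.sum_congr rfl fun j _ => ?_
    rw [map_smul, smul_eq_mul, mul_comm, dunklBilin_apply]
    rfl
  simp [hx]

end Specialization

/-! ### Exponents: the inverse lexicographic order and degrees. -/

section Order

variable {a a' c : Fin ℓ → ℕ}

theorem Prec.trans {a'' : Fin ℓ → ℕ} (h : Prec a'' a') (h' : Prec a' a) : Prec a'' a := by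
  obtain ⟨i, hi, hi'⟩ := h
  obtain ⟨j, hj, hj'⟩ := h'
  rcases lt_trichotomy i j with h | rfl | h
  · exact ⟨j, hi' j h ▸ hj, fun k hk => (hi' k (h.trans hk)).trans (hj' k hk)⟩
  · exact ⟨i, hi.trans hj, fun k hk => (hi' k hk).trans (hj' k hk)⟩
  · exact ⟨i, hj' i h ▸ hi, fun k hk => (hi' k hk).trans (hj' k (h.trans hk))⟩

theorem not_prec_self (a : Fin ℓ → ℕ) : ¬ Prec a a := fun ⟨_, h, _⟩ => lt_irrefl _ h

theorem Prec.add_right (h : Prec a' a) (c : Fin ℓ → ℕ) : Prec (a' + c) (a + c) := by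
  obtain ⟨i, hi, hi'⟩ := h
  refine ⟨i, Nat.add_lt_add_right hi _, fun j hj => ?_⟩
  rw [Pi.add_apply, Pi.add_apply, hi' j hj]

/-- The degree `∑ d_i a_i` of the monomial `u^a`. -/
def wt (d : Fin ℓ → ℕ) (a : Fin ℓ → ℕ) : ℕ := ∑ i, d i * a i

theorem wt_add (d a c : Fin ℓ → ℕ) : wt d (a + c) = wt d a + wt d c := by
  simp [wt, mul_add, Finset.sum_add_distrib]

theorem wt_single (d : Fin ℓ → ℕ) (k : Fin ℓ) (n : ℕ) : wt d (Pi.single k n) = d k * n := by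
  rw [wt, Finset.sum_eq_single k]
  · rw [Pi.single_eq_same]
  · intro i _ hi
    rw [Pi.single_eq_of_ne hi, mul_zero]
  · exact fun h => absurd (Finset.mem_univ k) h

theorem mul_le_wt (d a : Fin ℓ → ℕ) (i : Fin ℓ) : d i * a i ≤ wt d a :=
  Finset.single_le_sum (f := fun i => d i * a i) (fun _ _ => Nat.zero_le _) (Finset.mem_univ i)

theorem finite_wt_eq {d : Fin ℓ → ℕ} (hd : ∀ i, 0 < d i) (n : ℕ) :
    {a : Fin ℓ → ℕ | wt d a = n}.Finite := by
  refine (Set.finite_Iic (fun _ : Fin ℓ => n)).subset fun a ha i => ?_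
  have h1 := mul_le_wt d a i
  rw [show wt d a = n from ha] at h1
  exact (Nat.le_mul_of_pos_left _ (hd i)).trans h1

/-- The exponents of the same degree as `a` that precede `a`. -/
def lowSet (d a : Fin ℓ → ℕ) : Set (Fin ℓ → ℕ) := {a' | Prec a' a ∧ wt d a' = wt d a}

theorem lowSet_finite {d : Fin ℓ → ℕ} (hd : ∀ i, 0 < d i) (a : Fin ℓ → ℕ) :
    (lowSet d a).Finite :=
  (finite_wt_eq hd (wt d a)).subset fun _ h => h.2

/-- `a` is the largest exponent of its degree. -/
def IsTop (d a : Fin ℓ → ℕ) : Prop := ∀ a', wt d a' = wt d a → a' = a ∨ Prec a' a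

/-- An exponent of degree `d_k n` vanishing beyond `k` has `k`-th coordinate at most `n`, and
equality leaves no degree for the other coordinates. -/
theorem isTop_single {d : Fin ℓ → ℕ} (hd : ∀ i, 0 < d i) (k : Fin ℓ) (n : ℕ)
    (h : ∀ a, wt d a = d k * n → ∀ j, k < j → a j = 0) : IsTop d (Pi.single k n) := by
  intro a ha
  rw [wt_single] at ha
  have h1 := mul_le_wt d a k
  rw [ha] at h1
  rcases (Nat.le_of_mul_le_mul_left h1 (hd k)).lt_or_eq with h2 | h2
  · refine Or.inr ⟨k, by rwa [Pi.single_eq_same], fun j hj => ?_⟩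
    rw [h a ha j hj, Pi.single_eq_of_ne hj.ne']
  · refine Or.inl (funext fun i => ?_)
    by_cases hi : i = k
    · rw [hi, Pi.single_eq_same, h2]
    · rw [Pi.single_eq_of_ne hi]
      rw [wt, ← Finset.add_sum_erase _ _ (Finset.mem_univ k), h2] at ha
      have h3 : ∑ i ∈ Finset.univ.erase k, d i * a i = 0 := by omega
      have h4 := Finset.sum_eq_zero_iff.mp h3 i (Finset.mem_erase.mpr ⟨hi, Finset.mem_univ i⟩)
      exact (Nat.mul_eq_zero.mp h4).resolve_left (hd i).ne'

theorem isTop_single_one {d : Fin ℓ → ℕ} (hd : ∀ i, 0 < d i) (hmono : StrictMono d)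
    (k : Fin ℓ) : IsTop d (Pi.single k 1) := by
  refine isTop_single hd k 1 fun a ha j hj => ?_
  have h1 := mul_le_wt d a j
  rw [ha, mul_one] at h1
  by_contra h0
  exact absurd (hmono hj) (not_lt.mpr ((Nat.le_mul_of_pos_right _ (Nat.pos_of_ne_zero h0)).trans
    h1))

theorem isTop_single_last {d : Fin ℓ → ℕ} (hd : ∀ i, 0 < d i) {m : Fin ℓ} (hm : ∀ j, j ≤ m)
    (n : ℕ) : IsTop d (Pi.single m n) :=
  isTop_single hd m n fun _ _ j hj => absurd (hm j) (not_le.mpr hj)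

/-- A proper predecessor of `n ε_k` of the same degree involves a coordinate before `k`. -/
theorem exists_lt_of_mem_lowSet_single {d : Fin ℓ → ℕ} (hd : ∀ i, 0 < d i) {k : Fin ℓ} {n : ℕ}
    (ha : a ∈ lowSet d (Pi.single k n)) : ∃ i < k, a i ≠ 0 := by
  obtain ⟨⟨i, hi, hi'⟩, hw⟩ := ha
  -- The deciding coordinate of `n ε_k` must be nonzero.
  have hik : i = k := by
    by_contra h
    rw [Pi.single_eq_of_ne h] at hi
    exact absurd hi (Nat.not_lt_zero _)
  subst hik
  by_contra! h
  rw [wt_single, wt, Finset.sum_eq_single i] at hw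
  · rw [Pi.single_eq_same] at hi
    exact hi.ne (Nat.eq_of_mul_eq_mul_left (hd i) hw)
  · intro j _ hj
    rcases lt_or_gt_of_ne hj with h1 | h1
    · rw [h j h1, mul_zero]
    · rw [hi' j h1, Pi.single_eq_of_ne hj, mul_zero]
  · exact fun h => absurd (Finset.mem_univ i) h

end Order

/-! ### Monomials in generators and triangular substitutions. -/

section Monomials

/-- The monomial `u^a`. -/
def umon (u : Fin ℓ → MvPolynomial (Fin ℓ) ℂ) (a : Fin ℓ → ℕ) : MvPolynomial (Fin ℓ) ℂ :=
  ∏ i, u i ^ a i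

variable {u v : Fin ℓ → MvPolynomial (Fin ℓ) ℂ} {d : Fin ℓ → ℕ}

theorem umon_add (a c : Fin ℓ → ℕ) : umon u (a + c) = umon u a * umon u c := by
  simp [umon, pow_add, Finset.prod_mul_distrib]

theorem umon_zero : umon u 0 = 1 := by simp [umon]

theorem umon_single (k : Fin ℓ) (n : ℕ) : umon u (Pi.single k n) = u k ^ n := by
  rw [umon, Finset.prod_eq_single k]
  · rw [Pi.single_eq_same]
  · intro i _ hi
    rw [Pi.single_eq_of_ne hi, pow_zero]
  · exact fun h => absurd (Finset.mem_univ k) h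

theorem umon_isHomogeneous (hu : ∀ i, (u i).IsHomogeneous (d i)) (a : Fin ℓ → ℕ) :
    (umon u a).IsHomogeneous (wt d a) :=
  IsHomogeneous.prod _ _ _ fun i _ => (hu i).pow (a i)

theorem linearIndependent_umon (hu : AlgebraicIndependent ℂ u) :
    LinearIndependent ℂ (umon u) := by
  have h1 : LinearIndependent ℂ (aeval (R := ℂ) u ∘ fun m : Fin ℓ →₀ ℕ => monomial m (1 : ℂ)) :=
    (by simpa only [coe_basisMonomials] using (basisMonomials (Fin ℓ) ℂ).linearIndependent :
      LinearIndependent ℂ (fun m : Fin ℓ →₀ ℕ => monomial m (1 : ℂ))).map'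
      (aeval u).toLinearMap (LinearMap.ker_eq_bot.mpr hu)
  have h2 := h1.comp Finsupp.equivFunOnFinite.symm Finsupp.equivFunOnFinite.symm.injective
  convert h2 using 1
  funext a
  rw [Function.comp_apply, Function.comp_apply, aeval_monomial, map_one, one_mul,
    Finsupp.prod_fintype _ _ fun i => pow_zero _]
  rfl

/-- The span of the monomials `u^a'` of the same degree as `u^a` with `a' ≺ a`. -/
def low (u : Fin ℓ → MvPolynomial (Fin ℓ) ℂ) (d a : Fin ℓ → ℕ) :
    Submodule ℂ (MvPolynomial (Fin ℓ) ℂ) := Submodule.span ℂ (umon u '' lowSet d a)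

theorem umon_mem_low {a a' : Fin ℓ → ℕ} (h : a' ∈ lowSet d a) : umon u a' ∈ low u d a :=
  Submodule.subset_span ⟨a', h, rfl⟩

theorem umon_notMem_low (hu : AlgebraicIndependent ℂ u) (a : Fin ℓ → ℕ) :
    umon u a ∉ low u d a :=
  (linearIndependent_umon hu).notMem_span_image fun h => not_prec_self a h.1

theorem low_mono {a a' : Fin ℓ → ℕ} (h : a' ∈ lowSet d a) : low u d a' ≤ low u d a :=
  Submodule.span_mono (Set.image_mono fun _ h' => ⟨h'.1.trans h.1, h'.2.trans h.2⟩)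

theorem low_mul_umon {a : Fin ℓ → ℕ} {x : MvPolynomial (Fin ℓ) ℂ} (hx : x ∈ low u d a)
    (c : Fin ℓ → ℕ) : x * umon u c ∈ low u d (a + c) := by
  induction hx using Submodule.span_induction with
  | mem x hx =>
    obtain ⟨a', h, rfl⟩ := hx
    rw [← umon_add]
    exact umon_mem_low ⟨h.1.add_right c, by rw [wt_add, wt_add, h.2]⟩
  | zero => rw [zero_mul]; exact zero_mem _
  | add x y _ _ hx hy => rw [add_mul]; exact add_mem hx hy
  | smul z x _ hx => rw [smul_mul_assoc]; exact Submodule.smul_mem _ _ hx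

theorem low_mul_low {a c : Fin ℓ → ℕ} {x y : MvPolynomial (Fin ℓ) ℂ} (hx : x ∈ low u d a)
    (hy : y ∈ low u d c) : x * y ∈ low u d (a + c) := by
  induction hy using Submodule.span_induction with
  | mem y hy =>
    obtain ⟨c', h, rfl⟩ := hy
    refine low_mono (a' := a + c') ⟨?_, by rw [wt_add, wt_add, h.2]⟩ (low_mul_umon hx c')
    rw [add_comm a, add_comm a]
    exact h.1.add_right a
  | zero => rw [mul_zero]; exact zero_mem _
  | add x y _ _ hx hy => rw [mul_add]; exact add_mem hx hy
  | smul z x _ hx => rw [mul_smul_comm]; exact Submodule.smul_mem _ _ hx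

/-- `x` is `z u^a` plus smaller monomials of the same degree. -/
def HasLead (u : Fin ℓ → MvPolynomial (Fin ℓ) ℂ) (d a : Fin ℓ → ℕ) (z : ℂ)
    (x : MvPolynomial (Fin ℓ) ℂ) : Prop := x - z • umon u a ∈ low u d a

/-- Leading terms multiply because `≺` is compatible with addition. The value `z = 0` is allowed, so
a leading coefficient may vanish. -/
theorem HasLead.mul {a c : Fin ℓ → ℕ} {z z' : ℂ} {x y : MvPolynomial (Fin ℓ) ℂ}
    (hx : HasLead u d a z x) (hy : HasLead u d c z' y) :
    HasLead u d (a + c) (z * z') (x * y) := by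
  have h1 := low_mul_low hx hy
  have h2 := Submodule.smul_mem _ z' (low_mul_umon hx c)
  have h3 := Submodule.smul_mem _ z (low_mul_umon hy a)
  rw [add_comm c a] at h3
  have h4 := add_mem (add_mem h1 h2) h3
  rw [HasLead, umon_add]
  convert h4 using 1
  simp only [smul_eq_C_mul, C_mul]
  ring

theorem hasLead_one : HasLead u d 0 1 1 := by
  rw [HasLead, umon_zero, one_smul, sub_self]
  exact zero_mem _

theorem HasLead.umon {z : Fin ℓ → ℂ} (hv : ∀ i, HasLead u d (Pi.single i 1) (z i) (v i))
    (a : Fin ℓ → ℕ) : HasLead u d a (∏ i, z i ^ a i) (umon v a) := by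
  have hpow : ∀ i n, HasLead u d (Pi.single i n) (z i ^ n) (v i ^ n) := by
    intro i n
    induction n with
    | zero =>
      rw [Pi.single_zero, pow_zero, pow_zero]
      exact hasLead_one
    | succ n ih =>
      rw [Pi.single_add, pow_succ, pow_succ]
      exact ih.mul (hv i)
  have hprod : ∀ t : Finset (Fin ℓ), HasLead u d (∑ i ∈ t, Pi.single i (a i))
      (∏ i ∈ t, z i ^ a i) (∏ i ∈ t, v i ^ a i) := by
    intro t
    classical
    induction t using Finset.induction_on with
    | empty => exact hasLead_one
    | insert i t hi ih =>
      rw [Finset.sum_insert hi, Finset.prod_insert hi, Finset.prod_insert hi]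
      exact (hpow i (a i)).mul ih
  have := hprod Finset.univ
  rwa [Finset.univ_sum_single] at this

theorem HasLead.mem_low {a a' : Fin ℓ → ℕ} {z : ℂ} {x : MvPolynomial (Fin ℓ) ℂ}
    (hx : HasLead u d a' z x) (h : a' ∈ lowSet d a) : x ∈ low u d a := by
  have := add_mem (low_mono h hx) (Submodule.smul_mem _ z (umon_mem_low (u := u) h))
  rwa [sub_add_cancel] at this

/-- A triangular substitution of the generators does not raise leading exponents. -/
theorem low_le_low {z : Fin ℓ → ℂ} (hv : ∀ i, HasLead u d (Pi.single i 1) (z i) (v i))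
    (a : Fin ℓ → ℕ) : low v d a ≤ low u d a := by
  rw [low, Submodule.span_le]
  rintro _ ⟨a', h, rfl⟩
  exact (HasLead.umon hv a').mem_low h

theorem homogeneousComponent_mem_span {k σ ι : Type*} [Field k] {x : ι → MvPolynomial σ k}
    {w : ι → ℕ} (hx : ∀ i, (x i).IsHomogeneous (w i)) {s : Set ι} (n : ℕ)
    {f : MvPolynomial σ k} (hf : f ∈ Submodule.span k (x '' s)) :
    homogeneousComponent n f ∈ Submodule.span k (x '' {i | i ∈ s ∧ w i = n}) := by
  induction hf using Submodule.span_induction with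
  | mem f hf =>
    obtain ⟨i, hi, rfl⟩ := hf
    rw [homogeneousComponent_of_mem (hx i)]
    split_ifs with h
    · exact Submodule.subset_span ⟨i, ⟨hi, h.symm⟩, rfl⟩
    · exact zero_mem _
  | zero => rw [map_zero]; exact zero_mem _
  | add f g _ _ hf hg => rw [map_add]; exact add_mem hf hg
  | smul r f _ hf => rw [map_smul]; exact Submodule.smul_mem _ _ hf

end Monomials

/-! ### Independence of the generating set, and complex conjugation. -/

section GeneratingSets

variable {b : OrthonormalBasis (Fin ℓ) ℝ E} {W : Subgroup (E ≃ₗᵢ[ℝ] E)}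
  {d : Fin ℓ → ℕ} {u v : Fin ℓ → MvPolynomial (Fin ℓ) ℂ}

namespace IsHomogeneousGeneratingSet

/-- A generator of degree zero would be a constant, hence algebraic over `ℂ`. -/
theorem degree_pos (hu : IsHomogeneousGeneratingSet b W d u) (i : Fin ℓ) : 0 < d i := by
  by_contra h
  have h0 : d i = 0 := by omega
  have h1 := hu.1 i
  rw [h0, ← totalDegree_zero_iff_isHomogeneous] at h1
  refine hu.2.1.transcendental i ?_
  rw [totalDegree_eq_zero_iff_eq_C.mp h1]
  exact isAlgebraic_algebraMap _

theorem mem_invariants (hu : IsHomogeneousGeneratingSet b W d u) (i : Fin ℓ) :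
    u i ∈ invariants ℂ b W := by
  rw [← hu.2.2]
  exact Algebra.subset_adjoin ⟨i, rfl⟩

theorem umon_mem_invariants (hu : IsHomogeneousGeneratingSet b W d u) (a : Fin ℓ → ℕ) :
    umon u a ∈ invariants ℂ b W :=
  prod_mem fun i _ => pow_mem (hu.mem_invariants i) _

theorem mem_span_umon (hu : IsHomogeneousGeneratingSet b W d u) {f : MvPolynomial (Fin ℓ) ℂ}
    (hf : f ∈ invariants ℂ b W) : f ∈ Submodule.span ℂ (umon u '' Set.univ) := by
  rw [← hu.2.2, Algebra.adjoin_range_eq_range_aeval] at hf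
  obtain ⟨p, rfl⟩ := hf
  change aeval u p ∈ _
  rw [aeval_def, eval₂_eq']
  refine Submodule.sum_mem _ fun m _ => ?_
  rw [← Algebra.smul_def]
  exact Submodule.smul_mem _ _ (Submodule.subset_span ⟨m, trivial, rfl⟩)

theorem mem_span_umon_of_isHomogeneous (hu : IsHomogeneousGeneratingSet b W d u)
    {f : MvPolynomial (Fin ℓ) ℂ} (hf : f ∈ invariants ℂ b W) {n : ℕ} (hn : f.IsHomogeneous n) :
    f ∈ Submodule.span ℂ (umon u '' {a | wt d a = n}) := by
  have := homogeneousComponent_mem_span (umon_isHomogeneous hu.1) n (hu.mem_span_umon hf)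
  rw [homogeneousComponent_eq_self hn] at this
  simpa using this

theorem exists_hasLead (hu : IsHomogeneousGeneratingSet b W d u) {a : Fin ℓ → ℕ}
    (ha : IsTop d a) {f : MvPolynomial (Fin ℓ) ℂ} (hf : f ∈ invariants ℂ b W)
    (hn : f.IsHomogeneous (wt d a)) : ∃ z, HasLead u d a z f := by
  have h := hu.mem_span_umon_of_isHomogeneous hf hn
  have hs : {a' | wt d a' = wt d a} ⊆ insert a (lowSet d a) := fun a' h' =>
    (ha a' h').imp id fun h'' => ⟨h'', h'⟩
  have h1 := Submodule.span_mono (R := ℂ) (Set.image_mono (f := umon u) hs) h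
  rw [Set.image_insert_eq, Submodule.mem_span_insert] at h1
  obtain ⟨z, y, hy, rfl⟩ := h1
  refine ⟨z, ?_⟩
  rw [HasLead, add_sub_cancel_left]
  exact hy

/-- Here distinctness of the degrees enters: `ε_i` is then the largest exponent of degree `d_i`, so
invariants of these degrees are automatically triangular in `u`. Applied to other generating sets
and to conjugates. -/
theorem exists_hasLead_single (hu : IsHomogeneousGeneratingSet b W d u) (hd : StrictMono d)
    {f : Fin ℓ → MvPolynomial (Fin ℓ) ℂ} (hf : ∀ i, f i ∈ invariants ℂ b W)
    (hn : ∀ i, (f i).IsHomogeneous (d i)) :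
    ∃ z : Fin ℓ → ℂ, ∀ i, HasLead u d (Pi.single i 1) (z i) (f i) := by
  have := fun i => hu.exists_hasLead (isTop_single_one hu.degree_pos hd i) (hf i)
    (by rw [wt_single, mul_one]; exact hn i)
  choose z hz using this
  exact ⟨z, hz⟩

theorem low_eq (hu : IsHomogeneousGeneratingSet b W d u)
    (hv : IsHomogeneousGeneratingSet b W d v) (hd : StrictMono d) (a : Fin ℓ → ℕ) :
    low v d a = low u d a := by
  obtain ⟨z, hz⟩ := hu.exists_hasLead_single hd hv.mem_invariants hv.1
  obtain ⟨z', hz'⟩ := hv.exists_hasLead_single hd hu.mem_invariants hu.1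
  exact le_antisymm (low_le_low hz a) (low_le_low hz' a)

theorem exists_hasLead_umon (hu : IsHomogeneousGeneratingSet b W d u)
    (hv : IsHomogeneousGeneratingSet b W d v) (hd : StrictMono d) (a : Fin ℓ → ℕ) :
    ∃ z : ℂ, z ≠ 0 ∧ HasLead v d a z (umon u a) := by
  obtain ⟨z, hz⟩ := hv.exists_hasLead_single hd hu.mem_invariants hu.1
  have h := HasLead.umon hz a
  -- A zero leading coefficient would put `u^a` in `low v d a = low u d a`, against linear
  -- independence.
  refine ⟨_, fun h0 => umon_notMem_low hu.2.1 (d := d) a ?_, h⟩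
  rw [HasLead, h0, zero_smul, sub_zero] at h
  rwa [hu.low_eq hv hd] at h

end IsHomogeneousGeneratingSet

theorem act_conjPoly (w : E ≃ₗᵢ[ℝ] E) (f : MvPolynomial (Fin ℓ) ℂ) :
    act ℂ b w (conjPoly ℓ f) = conjPoly ℓ (act ℂ b w f) := by
  induction f using MvPolynomial.induction_on with
  | C r => rw [act_C, conjPoly, map_C, act_C]
  | add p q hp hq => simp only [map_add, hp, hq]
  | mul_X p j hp =>
    have h1 : conjPoly ℓ (X j) = X j := map_X _ _
    have h2 : conjPoly ℓ (linForm ℂ b (w (b j))) = linForm ℂ b (w (b j)) := by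
      rw [linForm, map_sum]
      refine Finset.sum_congr rfl fun i _ => ?_
      rw [conjPoly, map_mul, map_C, map_X]
      congr 2
      exact Complex.conj_ofReal _
    rw [map_mul, map_mul, map_mul, map_mul, hp, h1, act_X, h2]

theorem conjPoly_mem_invariants {f : MvPolynomial (Fin ℓ) ℂ} (hf : f ∈ invariants ℂ b W) :
    conjPoly ℓ f ∈ invariants ℂ b W := fun w hw => by rw [act_conjPoly, hf w hw]

theorem conjPoly_isHomogeneous {f : MvPolynomial (Fin ℓ) ℂ} {n : ℕ} (hf : f.IsHomogeneous n) :
    (conjPoly ℓ f).IsHomogeneous n := hf.map _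

/-- The conjugates of the generators are invariants of the same degrees, hence triangular in `u`.
This supplies the conjugation hypothesis of the nondegeneracy lemmas. -/
theorem conjPoly_umon_mem_low (hu : IsHomogeneousGeneratingSet b W d u) (hd : StrictMono d)
    {a a' : Fin ℓ → ℕ} (h : a' ∈ lowSet d a) : conjPoly ℓ (umon u a') ∈ low u d a := by
  obtain ⟨z, hz⟩ := hu.exists_hasLead_single hd
    (fun i => conjPoly_mem_invariants (hu.mem_invariants i))
    (fun i => conjPoly_isHomogeneous (hu.1 i))
  have h1 : conjPoly ℓ (umon u a') = umon (fun i => conjPoly ℓ (u i)) a' := by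
    simp [umon]
  rw [h1]
  exact (HasLead.umon hz a').mem_low h

end GeneratingSets

/-! ### Passing between `ℂ` and `ℂ(c)`. -/

section BaseChange

variable {b : OrthonormalBasis (Fin ℓ) ℝ E} {W : Subgroup (E ≃ₗᵢ[ℝ] E)}

/-- Descent by a `ℂ`-linear retraction `β` of `ℂ(c)` onto `ℂ`, applied to coefficients. -/
theorem mem_span_of_toSc_mem_span {s : Set (MvPolynomial (Fin ℓ) ℂ)}
    {g : MvPolynomial (Fin ℓ) ℂ}
    (hg : toSc ℓ W g ∈ Submodule.span (ParamField W) (toSc ℓ W '' s)) :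
    g ∈ Submodule.span ℂ s := by
  obtain ⟨β, hβ⟩ := (Algebra.linearMap ℂ (ParamField W)).exists_leftInverse_of_injective
    (LinearMap.ker_eq_bot.mpr (algebraMap ℂ (ParamField W)).injective)
  have hβ' : ∀ (r : ParamField W) (z : ℂ), β (r * algebraMap ℂ (ParamField W) z) = z * β r := by
    intro r z
    rw [mul_comm, ← Algebra.smul_def, map_smul, smul_eq_mul]
  have hβ1 : β 1 = 1 := by
    have := LinearMap.congr_fun hβ 1
    simpa using this
  -- `β` is only `ℂ`-linear; the extra factor `r` absorbs scalars of `ℂ(c)` in the induction.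
  have key : ∀ f ∈ Submodule.span (ParamField W) (toSc ℓ W '' s), ∀ r : ParamField W,
      ∃ h ∈ Submodule.span ℂ s, ∀ m, coeff m h = β (r * coeff m f) := by
    intro f hf
    induction hf using Submodule.span_induction with
    | mem f hf =>
      obtain ⟨p, hp, rfl⟩ := hf
      refine fun r => ⟨β r • p, Submodule.smul_mem _ _ (Submodule.subset_span hp), fun m => ?_⟩
      rw [toSc, coeff_map, hβ', coeff_smul, smul_eq_mul, mul_comm]
    | zero => exact fun r => ⟨0, zero_mem _, fun m => by simp⟩
    | add f f' _ _ hf hf' =>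
      intro r
      obtain ⟨h, h1, h2⟩ := hf r
      obtain ⟨h', h1', h2'⟩ := hf' r
      exact ⟨h + h', add_mem h1 h1', fun m => by
        rw [coeff_add, coeff_add, h2, h2', mul_add, map_add]⟩
    | smul t f _ hf =>
      intro r
      obtain ⟨h, h1, h2⟩ := hf (r * t)
      exact ⟨h, h1, fun m => by rw [h2, coeff_smul, smul_eq_mul, mul_assoc]⟩
  obtain ⟨h, h1, h2⟩ := key _ hg 1
  have : h = g := MvPolynomial.ext _ _ fun m => by
    rw [h2, toSc, coeff_map, hβ', hβ1, mul_one]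
  rwa [← this]

theorem toSc_mem_span {s : Set (MvPolynomial (Fin ℓ) ℂ)} {g : MvPolynomial (Fin ℓ) ℂ}
    (hg : g ∈ Submodule.span ℂ s) :
    toSc ℓ W g ∈ Submodule.span (ParamField W) (toSc ℓ W '' s) := by
  induction hg using Submodule.span_induction with
  | mem g hg => exact Submodule.subset_span ⟨g, hg, rfl⟩
  | zero => rw [map_zero]; exact zero_mem _
  | add f g _ _ hf hg => rw [map_add]; exact add_mem hf hg
  | smul z f _ hf => rw [toSc_smul]; exact Submodule.smul_mem _ _ hf

theorem toSc_mem_invariants {g : MvPolynomial (Fin ℓ) ℂ} (hg : g ∈ invariants ℂ b W) :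
    toSc ℓ W g ∈ invariants (ParamField W) b W := fun w hw => by
  rw [← toSc_act, hg w hw]

/-- An invariant is its own average over `W`, and the average of a monomial has complex
coefficients. -/
theorem mem_span_toSc_of_mem_invariants [Finite W] {f : Sc ℓ W}
    (hf : f ∈ invariants (ParamField W) b W) :
    f ∈ Submodule.span (ParamField W)
      (toSc ℓ W '' (invariants ℂ b W : Set (MvPolynomial (Fin ℓ) ℂ))) := by
  have := Fintype.ofFinite W
  have hcard : (Fintype.card W : ParamField W) ≠ 0 := Nat.cast_ne_zero.mpr Fintype.card_ne_zero
  have h1 : f = (Fintype.card W : ParamField W)⁻¹ •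
      ∑ w : W, act _ b (w : E ≃ₗᵢ[ℝ] E) f := by
    rw [Finset.sum_congr rfl fun (w : W) _ => hf w w.2, Finset.sum_const, Finset.card_univ,
      ← Nat.cast_smul_eq_nsmul (ParamField W), smul_smul, inv_mul_cancel₀ hcard, one_smul]
  have h2 : ∀ g : MvPolynomial (Fin ℓ) ℂ,
      ∑ w : W, act ℂ b (w : E ≃ₗᵢ[ℝ] E) g ∈ invariants ℂ b W := by
    intro g w hw
    rw [map_sum]
    refine Fintype.sum_equiv (Equiv.mulLeft (⟨w, hw⟩ : W)) _ _ fun w' => ?_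
    rw [← act_mul_apply]
    rfl
  rw [h1]
  refine Submodule.smul_mem _ _ ?_
  -- The sum over `W` is now treated for arbitrary `f`, since monomials of `f` need not be
  -- invariant.
  clear h1 hf
  induction f using MvPolynomial.induction_on' with
  | monomial m r =>
    have h3 : monomial m r = r • toSc ℓ W (monomial m 1) := by
      rw [toSc, map_monomial, map_one, smul_monomial, smul_eq_mul, mul_one]
    have h4 : ∑ w : W, act (ParamField W) b (w : E ≃ₗᵢ[ℝ] E) (monomial m r) =
        r • toSc ℓ W (∑ w : W, act ℂ b (w : E ≃ₗᵢ[ℝ] E) (monomial m 1)) := by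
      rw [map_sum, Finset.smul_sum]
      refine Finset.sum_congr rfl fun w _ => ?_
      rw [h3, map_smul, toSc_act]
    rw [h4]
    exact Submodule.smul_mem _ _ (Submodule.subset_span ⟨_, h2 _, rfl⟩)
  | add p q hp hq =>
    simp only [map_add, Finset.sum_add_distrib]
    exact add_mem hp hq

end BaseChange

/-! ### Monomials in the generators over `ℂ(c)`. -/

section Monomials

variable {b : OrthonormalBasis (Fin ℓ) ℝ E} {W : Subgroup (E ≃ₗᵢ[ℝ] E)}
  {d : Fin ℓ → ℕ} {u v : Fin ℓ → MvPolynomial (Fin ℓ) ℂ}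

theorem monom_eq (u : Fin ℓ → MvPolynomial (Fin ℓ) ℂ) (a : Fin ℓ → ℕ) :
    monom W u a = toSc ℓ W (umon u a) := rfl

theorem monom_add (a c : Fin ℓ → ℕ) : monom W u (a + c) = monom W u a * monom W u c := by
  rw [monom_eq, umon_add, map_mul, monom_eq, monom_eq]

theorem monom_image (s : Set (Fin ℓ → ℕ)) : monom W u '' s = toSc ℓ W '' (umon u '' s) := by
  rw [Set.image_image]
  rfl

theorem monom_isHomogeneous (hu : ∀ i, (u i).IsHomogeneous (d i)) (a : Fin ℓ → ℕ) :
    (monom W u a).IsHomogeneous (wt d a) := (umon_isHomogeneous hu a).map _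

variable (W) in
/-- The `ℂ(c)`-span of the monomials `u^a'` of the same degree as `u^a` with `a' ≺ a`. -/
def lowSc (u : Fin ℓ → MvPolynomial (Fin ℓ) ℂ) (d a : Fin ℓ → ℕ) :
    Submodule (ParamField W) (Sc ℓ W) := Submodule.span _ (monom W u '' lowSet d a)

theorem toSc_mem_lowSc {g : MvPolynomial (Fin ℓ) ℂ} {a : Fin ℓ → ℕ} (hg : g ∈ low u d a) :
    toSc ℓ W g ∈ lowSc W u d a := by
  rw [lowSc, monom_image]
  exact toSc_mem_span hg

theorem lowSc_mono {a : Fin ℓ → ℕ} (h : low u d a ≤ low v d a) :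
    lowSc W u d a ≤ lowSc W v d a := by
  rw [lowSc, Submodule.span_le]
  rintro _ ⟨a', ha', rfl⟩
  exact toSc_mem_lowSc (h (umon_mem_low ha'))

theorem lowSc_le_span_prec (a : Fin ℓ → ℕ) :
    lowSc W u d a ≤
      Submodule.span (ParamField W) {g | ∃ a', Prec a' a ∧ g = monom W u a'} := by
  refine Submodule.span_mono ?_
  rintro _ ⟨a', ha', rfl⟩
  exact ⟨a', ha'.1, rfl⟩

theorem lowSc_isHomogeneous (hu : ∀ i, (u i).IsHomogeneous (d i)) {a : Fin ℓ → ℕ} {f : Sc ℓ W}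
    (hf : f ∈ lowSc W u d a) : f.IsHomogeneous (wt d a) := by
  have : lowSc W u d a ≤ homogeneousSubmodule (Fin ℓ) (ParamField W) (wt d a) := by
    rw [lowSc, Submodule.span_le]
    rintro _ ⟨a', ha', rfl⟩
    rw [← ha'.2]
    exact monom_isHomogeneous hu a'
  exact this hf

theorem dunklForm_eq_zero_of_mem_span [Finite W] {s : Set (Sc ℓ W)} {f g : Sc ℓ W}
    (h : ∀ x ∈ s, dunklForm b W x f = 0) (hg : g ∈ Submodule.span (ParamField W) s) :
    dunklForm b W g f = 0 := by
  have : Submodule.span (ParamField W) s ≤ LinearMap.ker ((dunklBilin b W).flip f) :=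
    Submodule.span_le.mpr h
  exact this hg

theorem complex_smul_eq (z : ℂ) (f : Sc ℓ W) : z • f = algebraMap ℂ (ParamField W) z • f :=
  (algebraMap_smul (ParamField W) z f).symm

namespace IsHomogeneousGeneratingSet

theorem monom_mem_invariants (hu : IsHomogeneousGeneratingSet b W d u) (a : Fin ℓ → ℕ) :
    monom W u a ∈ invariants (ParamField W) b W :=
  toSc_mem_invariants (hu.umon_mem_invariants a)

theorem span_monom_le_invariants (hu : IsHomogeneousGeneratingSet b W d u)
    (s : Set (Fin ℓ → ℕ)) : Submodule.span (ParamField W) (monom W u '' s) ≤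
      Subalgebra.toSubmodule (invariants (ParamField W) b W) := by
  rw [Submodule.span_le]
  rintro _ ⟨a, _, rfl⟩
  exact hu.monom_mem_invariants a

theorem monom_notMem_lowSc (hu : IsHomogeneousGeneratingSet b W d u) (a : Fin ℓ → ℕ) :
    monom W u a ∉ lowSc W u d a := by
  intro h
  rw [lowSc, monom_image] at h
  exact umon_notMem_low hu.2.1 a (mem_span_of_toSc_mem_span h)

variable [Finite W]

theorem mem_span_monom (hu : IsHomogeneousGeneratingSet b W d u) {f : Sc ℓ W}
    (hf : f ∈ invariants (ParamField W) b W) :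
    f ∈ Submodule.span (ParamField W) (monom W u '' Set.univ) := by
  refine Submodule.span_le.mpr ?_ (mem_span_toSc_of_mem_invariants hf)
  rintro _ ⟨g, hg, rfl⟩
  rw [monom_image]
  exact toSc_mem_span (hu.mem_span_umon hg)

theorem homogeneousComponent_mem_span_monom (hu : IsHomogeneousGeneratingSet b W d u)
    {f : Sc ℓ W} (hf : f ∈ invariants (ParamField W) b W) (n : ℕ) :
    homogeneousComponent n f ∈
      Submodule.span (ParamField W) (monom W u '' {a | wt d a = n}) := by
  have := homogeneousComponent_mem_span (monom_isHomogeneous hu.1) n (hu.mem_span_monom hf)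
  simpa using this

theorem exists_sub_smul_mem_lowSc (hu : IsHomogeneousGeneratingSet b W d u) {a : Fin ℓ → ℕ}
    (ha : IsTop d a) {f : Sc ℓ W} (hf : f ∈ invariants (ParamField W) b W)
    (hn : f.IsHomogeneous (wt d a)) : ∃ r : ParamField W, f - r • monom W u a ∈ lowSc W u d a := by
  have h := hu.homogeneousComponent_mem_span_monom hf (wt d a)
  rw [homogeneousComponent_eq_self hn] at h
  have hs : {a' | wt d a' = wt d a} ⊆ insert a (lowSet d a) := fun a' h' =>
    (ha a' h').imp id fun h'' => ⟨h'', h'⟩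
  have h1 := Submodule.span_mono (R := ParamField W) (Set.image_mono (f := monom W u) hs) h
  rw [Set.image_insert_eq, Submodule.mem_span_insert] at h1
  obtain ⟨r, y, hy, rfl⟩ := h1
  refine ⟨r, ?_⟩
  rw [add_sub_cancel_left]
  exact hy

/-- The form is nondegenerate on the span of finitely many monomials, if their complex span is
stable under conjugation. -/
theorem eq_zero_of_mem_span_monom (hu : IsHomogeneousGeneratingSet b W d u)
    {s : Set (Fin ℓ → ℕ)} (hs : s.Finite)
    (hconj : ∀ a ∈ s, conjPoly ℓ (umon u a) ∈ Submodule.span ℂ (umon u '' s)) {g : Sc ℓ W}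
    (hg : g ∈ Submodule.span (ParamField W) (monom W u '' s))
    (h : ∀ a ∈ s, dunklForm b W (monom W u a) g = 0) : g = 0 := by
  have := hs.fintype
  rw [Set.image_eq_range] at hg
  refine eq_zero_of_dunklForm_eq_zero b (v := fun a : s => umon u a)
    ((linearIndependent_umon hu.2.1).comp _ Subtype.val_injective) (fun a => ?_) hg
    fun a => h a a.2
  have h2 := hconj a a.2
  rwa [Set.image_eq_range] at h2

theorem exists_orthogonal (hu : IsHomogeneousGeneratingSet b W d u)
    {s : Set (Fin ℓ → ℕ)} (hs : s.Finite)
    (hconj : ∀ a ∈ s, conjPoly ℓ (umon u a) ∈ Submodule.span ℂ (umon u '' s)) (g : Sc ℓ W) :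
    ∃ x ∈ Submodule.span (ParamField W) (monom W u '' s),
      ∀ a ∈ s, dunklForm b W (monom W u a) (g - x) = 0 := by
  have := hs.fintype
  obtain ⟨x, hx, h⟩ := exists_orthogonal_of_conj b (v := fun a : s => umon u a)
    ((linearIndependent_umon hu.2.1).comp _ Subtype.val_injective) (fun a => by
      have h2 := hconj a a.2
      rwa [Set.image_eq_range] at h2) g
  refine ⟨x, ?_, fun a ha => h ⟨a, ha⟩⟩
  rw [Set.image_eq_range]
  exact hx

/-- Nondegeneracy on all invariants of one degree: these are spanned by finitely many monomials, and
conjugation preserves complex invariants and degrees. -/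
theorem eq_zero_of_mem_invariants (hu : IsHomogeneousGeneratingSet b W d u) {n : ℕ} {g : Sc ℓ W}
    (hg : g ∈ invariants (ParamField W) b W) (hn : g.IsHomogeneous n)
    (h : ∀ a, wt d a = n → dunklForm b W (monom W u a) g = 0) : g = 0 := by
  refine hu.eq_zero_of_mem_span_monom (finite_wt_eq hu.degree_pos n) (fun a ha => ?_) ?_ h
  · refine hu.mem_span_umon_of_isHomogeneous
      (conjPoly_mem_invariants (hu.umon_mem_invariants a)) (conjPoly_isHomogeneous ?_)
    rw [← show wt d a = n from ha]
    exact umon_isHomogeneous hu.1 a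
  · rw [← homogeneousComponent_eq_self hn]
    exact hu.homogeneousComponent_mem_span_monom hg n

end IsHomogeneousGeneratingSet

end Monomials

/-! ### Canonical invariants: existence, Dunkl equations, generation. -/

section Canonical

variable {b : OrthonormalBasis (Fin ℓ) ℝ E} {W : Subgroup (E ≃ₗᵢ[ℝ] E)}
  {d : Fin ℓ → ℕ} {u : Fin ℓ → MvPolynomial (Fin ℓ) ℂ}

/-- The defining properties of a canonical invariant, graded and with respect to one homogeneous
generating set. -/
structure IsCanonicalFor (b : OrthonormalBasis (Fin ℓ) ℝ E) (W : Subgroup (E ≃ₗᵢ[ℝ] E))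
    (d : Fin ℓ → ℕ) (u : Fin ℓ → MvPolynomial (Fin ℓ) ℂ) (a : Fin ℓ → ℕ) (f : Sc ℓ W) : Prop where
  mem_invariants : f ∈ invariants (ParamField W) b W
  isHomogeneous : f.IsHomogeneous (wt d a)
  exists_lead : ∃ z : ParamField W, z ≠ 0 ∧ f - z • monom W u a ∈ lowSc W u d a
  orthogonal : ∀ a' ∈ lowSet d a, dunklForm b W (monom W u a') f = 0

theorem IsCanonicalFor.ne_zero {a : Fin ℓ → ℕ} {f : Sc ℓ W} (hf : IsCanonicalFor b W d u a f)
    (hu : IsHomogeneousGeneratingSet b W d u) : f ≠ 0 := by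
  rintro rfl
  obtain ⟨z, hz, h⟩ := hf.exists_lead
  rw [zero_sub, neg_mem_iff, Submodule.smul_mem_iff _ hz] at h
  exact hu.monom_notMem_lowSc a h

/-- The definition admits smaller monomials of any degree; homogeneity of `f` allows projecting to
the degree of `u^a`. -/
theorem IsCanonicalInvariant.isCanonicalFor {a : Fin ℓ → ℕ} {f : Sc ℓ W}
    (hf : IsCanonicalInvariant b W a f)
    (hu : IsHomogeneousGeneratingSet b W (degrees b W) u) :
    IsCanonicalFor b W (degrees b W) u a f := by
  obtain ⟨hinv, ⟨n, hn⟩, h⟩ := hf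
  obtain ⟨⟨z, hz, h1⟩, h2⟩ := h u hu
  have hz' : algebraMap ℂ (ParamField W) z ≠ 0 := (map_ne_zero _).mpr hz
  set d := degrees b W
  have h3 : {g | ∃ a', Prec a' a ∧ g = monom W u a'} = monom W u '' {a' | Prec a' a} := by
    ext g
    exact ⟨fun ⟨a', h, h'⟩ => ⟨a', h, h'.symm⟩, fun ⟨a', h, h'⟩ => ⟨a', h, h'.symm⟩⟩
  rw [h3] at h1
  have h4 := homogeneousComponent_mem_span (monom_isHomogeneous hu.1) (wt d a) h1
  have h5 : homogeneousComponent (wt d a) f -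
      algebraMap ℂ (ParamField W) z • monom W u a ∈ lowSc W u d a := by
    rw [complex_smul_eq, map_sub, map_smul,
      homogeneousComponent_eq_self (monom_isHomogeneous hu.1 a)] at h4
    exact h4
  -- Otherwise the component of `f` in the degree of `u^a` is zero, which puts `u^a` in the span of
  -- smaller monomials.
  have h6 : n = wt d a := by
    by_contra hne
    rw [homogeneousComponent_of_mem hn, if_neg (Ne.symm hne), zero_sub, neg_mem_iff,
      Submodule.smul_mem_iff _ hz'] at h5
    exact hu.monom_notMem_lowSc a h5
  subst h6
  rw [homogeneousComponent_eq_self hn] at h5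
  exact ⟨hinv, hn, ⟨_, hz', h5⟩, fun a' ha' => h2 a' ha'.1⟩

/-- Subtract from `u^a` its projection to `low`. As `low` is the same for every generating set `v`,
so is the resulting orthogonality; smaller monomials of other degrees are orthogonal by the grading.
-/
theorem exists_isCanonicalInvariant [Finite W] (hd : StrictMono (degrees b W))
    (hu : IsHomogeneousGeneratingSet b W (degrees b W) u) (a : Fin ℓ → ℕ) :
    ∃ f, IsCanonicalInvariant b W a f := by
  set d := degrees b W with hdef
  obtain ⟨x, hx, h⟩ := hu.exists_orthogonal (lowSet_finite hu.degree_pos a)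
    (fun a' ha' => conjPoly_umon_mem_low hu hd ha') (monom W u a)
  change x ∈ lowSc W u d a at hx
  have hhom : (monom W u a - x).IsHomogeneous (wt d a) :=
    (monom_isHomogeneous hu.1 a).sub (lowSc_isHomogeneous hu.1 hx)
  refine ⟨monom W u a - x, ?_, ⟨_, hhom⟩, fun v hv => ?_⟩
  · exact sub_mem (hu.monom_mem_invariants a) (hu.span_monom_le_invariants _ hx)
  · rw [← hdef] at hv
    refine ⟨?_, fun a' ha' => ?_⟩
    · obtain ⟨z, hz, hlead⟩ := hu.exists_hasLead_umon hv hd a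
      refine ⟨z, hz, lowSc_le_span_prec (d := d) a ?_⟩
      have h1 := toSc_mem_lowSc (W := W) hlead
      have h2 := lowSc_mono (W := W) (hv.low_eq hu hd a).le hx
      rw [map_sub, toSc_smul, ← complex_smul_eq] at h1
      have h3 := sub_mem h1 h2
      rwa [sub_right_comm] at h3
    · by_cases hw : wt d a' = wt d a
      · have h1 : monom W v a' ∈ lowSc W u d a :=
          toSc_mem_lowSc ((hu.low_eq hv hd a).le (umon_mem_low ⟨ha', hw⟩))
        refine dunklForm_eq_zero_of_mem_span ?_ h1
        rintro _ ⟨a'', ha'', rfl⟩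
        exact h a'' ha''
      · exact dunklForm_eq_zero_of_degree_ne b W (monom_isHomogeneous hv.1 a') hhom hw

theorem IsElementary.isCanonicalFor {a : Fin ℓ → ℕ} (htop : IsTop (degrees b W) a)
    (hu : IsHomogeneousGeneratingSet b W (degrees b W) u) {e : Sc ℓ W}
    (he : IsElementary b W (wt (degrees b W) a) e) :
    IsCanonicalFor b W (degrees b W) u a e := by
  obtain ⟨a', hw, hmax, h⟩ := he
  have : a' = a := by
    rcases htop a' hw with h1 | h1
    · exact h1
    · rcases hmax a rfl with h2 | h2
      · exact h2.symm
      · exact absurd (h1.trans h2) (not_prec_self a')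
  subst this
  exact h.isCanonicalFor hu

variable [Finite W]

/-- By adjointness, pairing `∇_{u^p} e` with `u^q` gives `(u^{q+p}, e)_c`, which is zero as soon as
`q + p ≺ n ε_k`; nondegeneracy on invariants concludes. -/
theorem IsCanonicalFor.dunklPoly_monom_eq_zero {k : Fin ℓ} {n : ℕ} {e : Sc ℓ W}
    (he : IsCanonicalFor b W d u (Pi.single k n) e) (hu : IsHomogeneousGeneratingSet b W d u)
    (htop : IsTop d (Pi.single k n)) {p : Fin ℓ → ℕ} (hp0 : wt d p ≠ 0) (hp : wt d p < d k) :
    dunklPoly b W (monom W u p) e = 0 := by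
  have hlow := lowersDegree_of_isHomogeneous b W (monom_isHomogeneous (W := W) hu.1 p)
  by_cases hle : wt d p ≤ wt d (Pi.single k n)
  · obtain ⟨m, hm⟩ := Nat.exists_eq_add_of_le hle
    refine hu.eq_zero_of_mem_invariants
      (dunklPoly_mem_invariants b W (hu.monom_mem_invariants p) he.mem_invariants)
      (hlow.1 m e (by rw [add_comm, ← hm]; exact he.isHomogeneous)) fun q hq => ?_
    rw [← dunklForm_mul, ← monom_add]
    have hw : wt d (q + p) = wt d (Pi.single k n) := by rw [wt_add, hq, hm, add_comm]
    rcases htop _ hw with h | h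
    -- If `q + p = n ε_k`, then `p` is a multiple of `ε_k`, and its degree is less than `d_k`, so `p
    -- = 0`.
    · exfalso
      apply hp0
      have hpk : p k = 0 := by
        by_contra h0
        have := (Nat.le_mul_of_pos_right (d k) (Nat.pos_of_ne_zero h0)).trans (mul_le_wt d p k)
        omega
      rw [wt]
      refine Finset.sum_eq_zero fun i _ => ?_
      by_cases hi : i = k
      · rw [hi, hpk, mul_zero]
      · have h1 := congrFun h i
        rw [Pi.add_apply, Pi.single_eq_of_ne hi] at h1
        rw [Nat.eq_zero_of_add_eq_zero_left h1, mul_zero]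
    · exact he.orthogonal _ ⟨h, hw⟩
  -- This case arises only for `n = 0`.
  · exact hlow.2 _ _ (not_le.mp hle) he.isHomogeneous

theorem dunklPoly_eq_zero_of_mem_span {s : Set (Sc ℓ W)} {f g : Sc ℓ W}
    (h : ∀ x ∈ s, dunklPoly b W x f = 0) (hg : g ∈ Submodule.span (ParamField W) s) :
    dunklPoly b W g f = 0 := by
  induction hg using Submodule.span_induction with
  | mem x hx => exact h x hx
  | zero => exact congrArg (fun T => T f) (map_zero (dunklPolyLin b W))
  | add x y _ _ hx hy => rw [dunklPoly_add, LinearMap.add_apply, hx, hy, add_zero]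
  | smul r x _ hx => rw [dunklPoly_smul, LinearMap.smul_apply, hx, smul_zero]

theorem IsCanonicalFor.dunklPoly_eq_zero {k : Fin ℓ} {n : ℕ} {e : Sc ℓ W}
    (he : IsCanonicalFor b W d u (Pi.single k n) e) (hu : IsHomogeneousGeneratingSet b W d u)
    (htop : IsTop d (Pi.single k n)) {P : Sc ℓ W} (hP : P ∈ invariants (ParamField W) b W)
    (hP0 : constantCoeff P = 0) (hdeg : P.totalDegree < d k) : dunklPoly b W P e = 0 := by
  have hcomp : ∀ j < d k, dunklPoly b W (homogeneousComponent j P) e = 0 := by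
    intro j hj
    by_cases hj0 : j = 0
    · rw [hj0, homogeneousComponent_zero, ← constantCoeff_eq, hP0, dunklPoly_C, zero_smul]
    · refine dunklPoly_eq_zero_of_mem_span ?_ (hu.homogeneousComponent_mem_span_monom hP j)
      rintro _ ⟨p, rfl, rfl⟩
      exact he.dunklPoly_monom_eq_zero hu htop hj0 hj
  conv_lhs => rw [← sum_homogeneousComponent P]
  change (dunklPolyLin b W _) e = 0
  rw [map_sum, LinearMap.sum_apply]
  exact Finset.sum_eq_zero fun j hj => hcomp j (by have := Finset.mem_range.mp hj; omega)

/-- The multiple of `e` is chosen to cancel the leading term of `f`. The difference lies in `low`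
and is orthogonal to it, since every monomial there contains a `u_i` with `i < k` and `∇_{u_i} f =
0`. Only these generators need to be tested. -/
theorem IsCanonicalFor.exists_eq_smul {k : Fin ℓ} {n : ℕ} {e f : Sc ℓ W}
    (he : IsCanonicalFor b W d u (Pi.single k n) e) (hu : IsHomogeneousGeneratingSet b W d u)
    (hd : StrictMono d) (htop : IsTop d (Pi.single k n))
    (hf : f ∈ invariants (ParamField W) b W) (hn : f.IsHomogeneous (wt d (Pi.single k n)))
    (h : ∀ i < k, dunklPoly b W (toSc ℓ W (u i)) f = 0) : ∃ r : ParamField W, f = r • e := by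
  obtain ⟨r, hr⟩ := hu.exists_sub_smul_mem_lowSc htop hf hn
  obtain ⟨z, hz, he'⟩ := he.exists_lead
  refine ⟨r * z⁻¹, sub_eq_zero.mp ?_⟩
  have hmem : f - (r * z⁻¹) • e ∈ lowSc W u d (Pi.single k n) := by
    have h1 := sub_mem hr (Submodule.smul_mem _ (r * z⁻¹) he')
    rw [smul_sub, smul_smul, inv_mul_cancel_right₀ hz] at h1
    convert h1 using 1
    abel
  refine hu.eq_zero_of_mem_span_monom (lowSet_finite hu.degree_pos _)
    (fun a' ha' => conjPoly_umon_mem_low hu hd ha') hmem fun a ha => ?_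
  rw [← dunklBilin_apply, map_sub, map_smul, dunklBilin_apply, dunklBilin_apply,
    he.orthogonal a ha, smul_zero, sub_zero]
  obtain ⟨i, hi, hai⟩ := exists_lt_of_mem_lowSet_single hu.degree_pos ha
  have hsplit : a = (a - Pi.single i 1) + Pi.single i 1 := by
    funext j
    by_cases hj : j = i
    · subst hj
      simp only [Pi.add_apply, Pi.sub_apply, Pi.single_eq_same]
      omega
    · simp [Pi.single_eq_of_ne hj]
  rw [hsplit, monom_add, dunklForm_mul, monom_eq u (Pi.single i 1), umon_single, pow_one, h i hi,
    dunklForm, map_zero, map_zero]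

/-- `e_k` is a nonzero multiple of `u_k` plus a polynomial in the `u_i` with `i < k`, so the `u_k`
are recovered recursively. -/
theorem adjoin_eq_invariants (hu : IsHomogeneousGeneratingSet b W d u) {e : Fin ℓ → Sc ℓ W}
    (he : ∀ k, IsCanonicalFor b W d u (Pi.single k 1) (e k)) :
    Algebra.adjoin (ParamField W) (Set.range e) = invariants (ParamField W) b W := by
  refine le_antisymm (Algebra.adjoin_le ?_) fun f hf => ?_
  · rintro _ ⟨k, rfl⟩
    exact (he k).mem_invariants
  set A := Algebra.adjoin (ParamField W) (Set.range e)
  have hmem : ∀ k, toSc ℓ W (u k) ∈ A := by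
    intro k
    induction k using WellFoundedLT.induction with
    | _ k ih =>
      obtain ⟨z, hz, hlow⟩ := (he k).exists_lead
      have hle : lowSc W u d (Pi.single k 1) ≤ Subalgebra.toSubmodule A := by
        rw [lowSc, Submodule.span_le]
        rintro _ ⟨a, ha, rfl⟩
        rw [monom_eq, umon, map_prod]
        change _ ∈ A
        refine prod_mem fun i _ => ?_
        rw [map_pow]
        by_cases hi : i < k
        · exact pow_mem (ih i hi) _
        · obtain ⟨j, hj, hj'⟩ := ha.1
          have hjk : j = k := by
            by_contra h
            rw [Pi.single_eq_of_ne h] at hj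
            exact absurd hj (Nat.not_lt_zero _)
          subst hjk
          have h0 : a i = 0 := by
            rcases (not_lt.mp hi).eq_or_lt with h | h
            · rw [← h]
              rw [Pi.single_eq_same] at hj
              omega
            · rw [hj' i h, Pi.single_eq_of_ne h.ne']
          rw [h0, pow_zero]
          exact one_mem _
      have h1 : z • monom W u (Pi.single k 1) ∈ Subalgebra.toSubmodule A := by
        have h2 := sub_mem (show e k ∈ Subalgebra.toSubmodule A from
          Algebra.subset_adjoin ⟨k, rfl⟩) (hle hlow)
        rwa [sub_sub_cancel] at h2
      rw [Submodule.smul_mem_iff _ hz, monom_eq, umon_single, pow_one] at h1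
      exact h1
  have hle : Submodule.span (ParamField W) (monom W u '' Set.univ) ≤
      Subalgebra.toSubmodule A := by
    rw [Submodule.span_le]
    rintro _ ⟨a, _, rfl⟩
    rw [monom_eq, umon, map_prod]
    change _ ∈ A
    exact prod_mem fun i _ => by rw [map_pow]; exact pow_mem (hmem i) _
  exact hle (hu.mem_span_monom hf)

end Canonical

/-! ### Existence of generating sets from strictly increasing `degrees`. -/

section SmallRank

/-- An isometry of a line is `±1`, so it acts diagonally on monomials. -/
theorem exists_coeff_act_rank_one (b : OrthonormalBasis (Fin 1) ℝ E) (w : E ≃ₗᵢ[ℝ] E) :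
    ∃ ε : ℂ, (ε = 1 ∨ ε = -1) ∧
      ∀ f m, coeff m (act ℂ b w f) = ε ^ m 0 * coeff m f := by
  set r : ℝ := inner ℝ (b 0) (w (b 0)) with hr
  have h1 : w (b 0) = r • b 0 := by
    conv_lhs => rw [← b.sum_repr' (w (b 0))]
    simp [hr]
  have h2 : r = 1 ∨ r = -1 := by
    have h3 : ‖w (b 0)‖ = 1 := by rw [w.norm_map, b.norm_eq_one]
    rw [h1, norm_smul, b.norm_eq_one, mul_one, Real.norm_eq_abs] at h3
    exact eq_or_eq_neg_of_abs_eq h3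
  refine ⟨(r : ℂ), ?_, fun f m => ?_⟩
  · rcases h2 with h | h
    · left; rw [h, Complex.ofReal_one]
    · right; rw [h, Complex.ofReal_neg, Complex.ofReal_one]
  · have hX : act ℂ b w (X 0) = C (r : ℂ) * X 0 := by
      rw [act_X, h1, linForm_smul, linForm_basis]
      rfl
    induction f using MvPolynomial.induction_on' with
    | monomial n z =>
      have h4 : act ℂ b w (monomial n z) = C ((r : ℂ) ^ n 0) * monomial n z := by
        have h5 : monomial n z = C z * X 0 ^ n 0 := by
          rw [monomial_eq, Finsupp.prod_fintype _ _ fun i => pow_zero _]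
          simp
        rw [h5, map_mul, act_C, map_pow, hX, mul_pow, C_pow]
        ring
      rw [h4, coeff_C_mul, coeff_monomial]
      split_ifs with h
      · rw [h]
      · rw [mul_zero, mul_zero]
    | add p q hp hq => rw [map_add, coeff_add, coeff_add, hp, hq, mul_add]

/-- In rank one the invariants are generated by a power of the variable. -/
theorem exists_generatingSet_rank_one (b : OrthonormalBasis (Fin 1) ℝ E)
    (W : Subgroup (E ≃ₗᵢ[ℝ] E)) :
    ∃ d : Fin 1 → ℕ, Monotone d ∧ ∃ u, IsHomogeneousGeneratingSet b W d u := by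
  choose ε hε hact using exists_coeff_act_rank_one b
  -- `n` is the order of the image of `W` in `{±1}`; the invariant monomials are the powers of `X 0
  -- ^ n`.
  obtain ⟨n, hn, h1, h2⟩ : ∃ n : ℕ, 0 < n ∧ (∀ w ∈ W, ε w ^ n = 1) ∧
      ∀ q : ℕ, (∀ w ∈ W, ε w ^ q = 1) → n ∣ q := by
    by_cases h : ∀ w ∈ W, ε w = 1
    · exact ⟨1, one_pos, fun w hw => by rw [h w hw, one_pow], fun q _ => one_dvd q⟩
    · push Not at h
      obtain ⟨w, hw, hw1⟩ := h
      have hw2 := (hε w).resolve_left hw1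
      refine ⟨2, two_pos, fun w _ => ?_, fun q hq => ?_⟩
      · rcases hε w with h | h <;> rw [h] <;> norm_num
      · have h3 := hq w hw
        rw [hw2, neg_one_pow_eq_one_iff_even (by norm_num)] at h3
        exact h3.two_dvd
  refine ⟨fun _ => n, monotone_const, fun _ => X 0 ^ n, fun _ => ?_, ?_, ?_⟩
  · simpa using (isHomogeneous_X ℂ (0 : Fin 1)).pow n
  · rw [algebraicIndependent_unique_type_iff]
    exact ((algebraicIndependent_X (Fin 1) ℂ).transcendental 0).pow hn
  · refine le_antisymm (Algebra.adjoin_le ?_) fun f hf => ?_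
    · rintro _ ⟨_, rfl⟩ w hw
      refine MvPolynomial.ext _ _ fun m => ?_
      rw [hact, coeff_X_pow]
      split_ifs with h
      · rw [← h, Finsupp.single_eq_same, h1 w hw, one_mul]
      · rw [mul_zero]
    · rw [f.as_sum]
      refine sum_mem fun m hm => ?_
      have hm0 := mem_support_iff.mp hm
      obtain ⟨q, hq⟩ := h2 (m 0) fun w hw => by
        have h3 := hact w f m
        rw [hf w hw] at h3
        exact mul_right_cancel₀ hm0 (by rw [← h3, one_mul])
      have h5 : monomial m (coeff m f) = coeff m f • (X 0 ^ n) ^ q := by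
        rw [monomial_eq, Finsupp.prod_fintype _ _ fun i => pow_zero _, smul_eq_C_mul, ← pow_mul,
          ← hq]
        simp
      rw [h5]
      exact Subalgebra.smul_mem _ (pow_mem (Algebra.subset_adjoin (Set.mem_range_self 0)) q) _

theorem exists_generatingSet_rank_zero (b : OrthonormalBasis (Fin 0) ℝ E)
    (W : Subgroup (E ≃ₗᵢ[ℝ] E)) :
    ∃ d : Fin 0 → ℕ, Monotone d ∧ ∃ u, IsHomogeneousGeneratingSet b W d u := by
  refine ⟨0, monotone_const, 0, fun i => i.elim0, ?_, ?_⟩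
  · rw [algebraicIndependent_empty_type_iff]
    exact C_injective _ _
  · refine SetLike.ext fun f => ?_
    rw [eq_C_of_isEmpty f]
    exact iff_of_true (Subalgebra.algebraMap_mem _ _) (Subalgebra.algebraMap_mem _ _)

/-- Chevalley's theorem is not needed: without a generating set `degrees` takes its default value
`0`, which is strictly increasing only if `ℓ ≤ 1`, and in rank at most one generators are explicit.
-/
theorem exists_isHomogeneousGeneratingSet (b : OrthonormalBasis (Fin ℓ) ℝ E)
    (W : Subgroup (E ≃ₗᵢ[ℝ] E)) (hd : StrictMono (degrees b W)) :
    ∃ u, IsHomogeneousGeneratingSet b W (degrees b W) u := by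
  have h : ∃ d : Fin ℓ → ℕ, Monotone d ∧ ∃ u, IsHomogeneousGeneratingSet b W d u := by
    by_contra h
    have h0 : degrees b W = 0 := dif_neg h
    have : Subsingleton (Fin ℓ) := ⟨fun i j => hd.injective (by rw [h0]; rfl)⟩
    obtain rfl | rfl := Nat.le_one_iff_eq_zero_or_eq_one.mp (Fin.subsingleton_iff_le_one.mp this)
    · exact h (exists_generatingSet_rank_zero b W)
    · exact h (exists_generatingSet_rank_one b W)
  have h1 : degrees b W = h.choose := dif_pos h
  rw [h1]
  exact h.choose_spec.2

end SmallRank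

end Dunkl

end

/-! ### The main theorem. -/

theorem mainTheorem5 {E : Type*} [NormedAddCommGroup E] [InnerProductSpace ℝ E] {ℓ : ℕ}
    (b : OrthonormalBasis (Fin ℓ) ℝ E) (W : Subgroup (E ≃ₗᵢ[ℝ] E)) [Finite W]
    (hW : Subgroup.closure {s | s ∈ W ∧ Dunkl.IsReflection s} = W)
    (hd : StrictMono (Dunkl.degrees b W)) :
    -- the canonical elementary invariants exist
    (∀ k, ∃ e, Dunkl.IsElementary b W (Dunkl.degrees b W k) e) ∧
    -- they generate the algebra of invariants
    (∀ e : Fin ℓ → Dunkl.Sc ℓ W,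
      (∀ k, Dunkl.IsElementary b W (Dunkl.degrees b W k) (e k)) →
        Algebra.adjoin (Dunkl.ParamField W) (Set.range e) =
          Dunkl.invariants (Dunkl.ParamField W) b W) ∧
    -- each of them is characterized up to a multiple by its degree and the Dunkl equations
    (∀ k, ∀ e, Dunkl.IsElementary b W (Dunkl.degrees b W k) e →
      e ∈ Dunkl.invariants (Dunkl.ParamField W) b W ∧
      e.IsHomogeneous (Dunkl.degrees b W k) ∧ e ≠ 0 ∧
      ∀ f ∈ Dunkl.invariants (Dunkl.ParamField W) b W,
        f.IsHomogeneous (Dunkl.degrees b W k) →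
        ((∀ P ∈ Dunkl.invariants (Dunkl.ParamField W) b W,
            MvPolynomial.constantCoeff P = 0 → P.totalDegree < Dunkl.degrees b W k →
            Dunkl.dunklPoly b W P f = 0) ↔
          ∃ r : Dunkl.ParamField W, f = r • e)) ∧
    -- the canonical quasiharmonic invariants; `m` is the last index, so that `h = d_m`
    (∀ m : Fin ℓ, (∀ j, j ≤ m) → ∀ k : ℕ, 1 ≤ k →
      ∃ e, Dunkl.IsElementary b W (k * Dunkl.degrees b W m) e ∧
        e ∈ Dunkl.invariants (Dunkl.ParamField W) b W ∧
        e.IsHomogeneous (k * Dunkl.degrees b W m) ∧ e ≠ 0 ∧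
        ∀ f ∈ Dunkl.invariants (Dunkl.ParamField W) b W,
          f.IsHomogeneous (k * Dunkl.degrees b W m) →
          ((∀ P ∈ Dunkl.invariants ℂ b W,
              MvPolynomial.constantCoeff P = 0 → P.totalDegree < Dunkl.degrees b W m →
              Dunkl.dunklPoly b W (Dunkl.toSc ℓ W P) f = 0) ↔
            ∃ r : Dunkl.ParamField W, f = r • e)) := by
  obtain ⟨u, hu⟩ := Dunkl.exists_isHomogeneousGeneratingSet b W hd
  have hpos := hu.degree_pos
  have hwt : ∀ k, Dunkl.degrees b W k = Dunkl.wt (Dunkl.degrees b W) (Pi.single k 1) :=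
    fun k => by rw [Dunkl.wt_single, mul_one]
  have hwt' : ∀ m k, k * Dunkl.degrees b W m = Dunkl.wt (Dunkl.degrees b W) (Pi.single m k) :=
    fun m k => by rw [Dunkl.wt_single, mul_comm]
  have htop := Dunkl.isTop_single_one hpos hd
  have hcan : ∀ k e, Dunkl.IsElementary b W (Dunkl.degrees b W k) e →
      Dunkl.IsCanonicalFor b W (Dunkl.degrees b W) u (Pi.single k 1) e :=
    fun k e he => Dunkl.IsElementary.isCanonicalFor (htop k) hu (hwt k ▸ he)
  have hconst : ∀ i, MvPolynomial.constantCoeff (u i) = 0 := fun i => by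
    rw [MvPolynomial.constantCoeff_eq]
    exact (hu.1 i).coeff_eq_zero (by rw [map_zero]; exact (hpos i).ne)
  refine ⟨fun k => ?_, fun e he => ?_, fun k e he => ?_, fun m hm k hk => ?_⟩
  · obtain ⟨e, he⟩ := Dunkl.exists_isCanonicalInvariant hd hu (Pi.single k 1)
    exact ⟨e, Pi.single k 1, (hwt k).symm, fun a' ha' => htop k a' (ha'.trans (hwt k)), he⟩
  · exact Dunkl.adjoin_eq_invariants hu fun k => hcan k (e k) (he k)
  · have hc := hcan k e he
    refine ⟨hc.mem_invariants, hwt k ▸ hc.isHomogeneous, hc.ne_zero hu, fun f hf hfn =>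
      ⟨fun h => hc.exists_eq_smul hu hd (htop k) hf (hwt k ▸ hfn) fun i hi => ?_, ?_⟩⟩
    -- The equations are used only for `P = u_i` with `i < k`, which is admissible because `d_i <
    -- d_k`.
    · refine h _ (Dunkl.toSc_mem_invariants (hu.mem_invariants i)) ?_ ?_
      · rw [Dunkl.toSc, MvPolynomial.constantCoeff_map, hconst, map_zero]
      · exact (((hu.1 i).map _).totalDegree_le).trans_lt (hd hi)
    · rintro ⟨r, rfl⟩ P hP hP0 hdeg
      rw [map_smul, hc.dunklPoly_eq_zero hu (htop k) hP hP0 hdeg, smul_zero]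
  · have htop' := Dunkl.isTop_single_last hpos hm k
    obtain ⟨e, he⟩ := Dunkl.exists_isCanonicalInvariant hd hu (Pi.single m k)
    have hc := he.isCanonicalFor hu
    rw [hwt' m k]
    refine ⟨e, ⟨Pi.single m k, rfl, htop', he⟩, hc.mem_invariants, hc.isHomogeneous,
      hc.ne_zero hu, fun f hf hfn => ⟨fun h => hc.exists_eq_smul hu hd htop' hf hfn
        fun i hi => h _ (hu.mem_invariants i) (hconst i) ?_, ?_⟩⟩
    · exact (hu.1 i).totalDegree_le.trans_lt (hd hi)
    · rintro ⟨r, rfl⟩ P hP hP0 hdeg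
      rw [map_smul, hc.dunklPoly_eq_zero hu htop' (Dunkl.toSc_mem_invariants hP) ?_ ?_, smul_zero]
      · rw [Dunkl.toSc, MvPolynomial.constantCoeff_map, hP0, map_zero]
      -- Extension of scalars does not enlarge the support, so the degree bound persists.
      · refine lt_of_le_of_lt ?_ hdeg
        exact Finset.sup_mono (MvPolynomial.support_map_subset _ _)
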